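/- Let $R$ be a Banach ring, i.e. a commutative unital ring that is complete for a norm $|\cdot|$ (an additive, symmetric, definite norm) with $|ab|\le C|a||b|$ for some constant $C>0$. Let $\mathsf{Ban}_R$ be the category of Banach $R$-modules (complete normed $R$-modules $M$ with $\|am\|\le C_M|a|\,\|m\|$ for some $C_M>0$) and bounded $R$-linear maps, with the completed projective tensor product $\widehat\otimes_R$, the internal Hom $\underline{\mathrm{Hom}}(W,V)$ of bounded $R$-linear maps with the operator norm, and the duals $W^\vee=\underline{\mathrm{Hom}}(W,R)$. For $W$ in $\mathsf{Ban}_R$ extend $W^\vee\widehat\otimes_R(-)$ and $\underline{\mathrm{Hom}}(W,-)$ to the ind-completion $\mathsf{Ind}(\mathsf{Ban}_R)$ by $W^\vee\widehat\otimes_R\text{``}\mathrm{colim}\text{''}V_j=\text{``}\mathrm{colim}\text{''}(W^\vee\widehat\otimes_R V_j)$ and $\underline{\mathrm{Hom}}(W,\text{``}\mathrm{colim}\text{''}V_j)=\text{``}\mathrm{colim}\text{''}\,\underline{\mathrm{Hom}}(W,V_j)$. An object $V$ of $\mathsf{Ind}(\mathsf{Ban}_R)$ is called nuclear if for every Banach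 $R$-module $W$ the natural morphism $W^\vee\widehat\otimes_R V\to\underline{\mathrm{Hom}}(W,V)$, induced by $\alpha\otimes v\mapsto(w\mapsto\alpha(w)v)$, is an isomorphism. Then: 1. If $(V_i)_{i\in I}$ is a countable family of nuclear objects of $\mathsf{Ind}(\mathsf{Ban}_R)$, then the product $\prod_{i\in I}V_i$ exists in $\mathsf{Ind}(\mathsf{Ban}_R)$ and is nuclear. 2. If $(V_i)_{i\in I}$ is any small family of nuclear objects of $\mathsf{Ind}(\mathsf{Ban}_R)$, then the coproduct $\coprod_{i\in I}V_i$ exists in $\mathsf{Ind}(\mathsf{Ban}_R)$ and is nuclear. -/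

import Mathlib

open CategoryTheory CategoryTheory.Limits
open scoped TensorProduct

universe u

/-! ### Banach rings and Banach modules -/

/-- A Banach ring: a commutative unital ring with a complete norm, whose multiplication is bounded.
The norm is neither required to be submultiplicative nor to satisfy `‖1‖ = 1`. -/
class BanachRing (R : Type u) extends CommRing R, NormedAddCommGroup R where
  exists_norm_mul_le : ∃ C : ℝ, 0 < C ∧ ∀ a b : R, ‖a * b‖ ≤ C * ‖a‖ * ‖b‖
  complete : CompleteSpace R

attribute [instance] BanachRing.complete

/-- A Banach module over a Banach ring: a complete normed module with bounded scalar
multiplication. -/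
class BanachModule (R : Type u) [BanachRing R] (M : Type u) [NormedAddCommGroup M] extends
    Module R M where
  exists_norm_smul_le : ∃ C : ℝ, 0 < C ∧ ∀ (a : R) (m : M), ‖a • m‖ ≤ C * ‖a‖ * ‖m‖
  complete : CompleteSpace M

attribute [instance] BanachModule.complete

instance BanachRing.selfModule (R : Type u) [BanachRing R] : BanachModule R R where
  exists_norm_smul_le := BanachRing.exists_norm_mul_le
  complete := inferInstance

/-! ### Bounded linear maps and the internal Hom -/

section InternalHom

variable (R : Type u) [BanachRing R]

/-- The `R`-module of bounded `R`-linear maps between two Banach modules. -/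
abbrev BoundedMap (M N : Type u) [NormedAddCommGroup M] [BanachModule R M]
    [NormedAddCommGroup N] [BanachModule R N] : Type u :=
  ({ carrier := {f | ∃ C : ℝ, 0 < C ∧ ∀ m, ‖f m‖ ≤ C * ‖m‖}
     add_mem' := by
       rintro f g ⟨C, hC, hf⟩ ⟨D, hD, hg⟩
       refine ⟨C + D, by positivity, fun m => ?_⟩
       calc ‖f m + g m‖ ≤ ‖f m‖ + ‖g m‖ := norm_add_le _ _
         _ ≤ C * ‖m‖ + D * ‖m‖ := add_le_add (hf m) (hg m)
         _ = (C + D) * ‖m‖ := by ring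
     zero_mem' := ⟨1, one_pos, fun m => by simp⟩
     smul_mem' := by
       rintro a f ⟨C, hC, hf⟩
       obtain ⟨D, hD, h⟩ := BanachModule.exists_norm_smul_le (R := R) (M := N)
       refine ⟨D * ‖a‖ * C + 1, by positivity, fun m => ?_⟩
       calc ‖a • f m‖ ≤ D * ‖a‖ * ‖f m‖ := h _ _
         _ ≤ D * ‖a‖ * (C * ‖m‖) := by gcongr; exact hf m
         _ ≤ (D * ‖a‖ * C + 1) * ‖m‖ := by nlinarith [norm_nonneg m] } :
    Submodule R (M →ₗ[R] N))

namespace BoundedMap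

variable {R}
variable {M N P : Type u} [NormedAddCommGroup M] [BanachModule R M]
  [NormedAddCommGroup N] [BanachModule R N] [NormedAddCommGroup P] [BanachModule R P]

/-- The operator norm `‖f‖ = sup_{m ≠ 0} ‖f m‖ / ‖m‖` (the term at `m = 0` is `0`). -/
noncomputable def opNorm (f : BoundedMap R M N) : ℝ := ⨆ m : M, ‖f.1 m‖ / ‖m‖

lemma bddAbove_opNorm (f : BoundedMap R M N) :
    BddAbove (Set.range fun m : M => ‖f.1 m‖ / ‖m‖) := by
  obtain ⟨C, hC, h⟩ := f.2
  refine ⟨C, ?_⟩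
  rintro _ ⟨m, rfl⟩
  exact div_le_of_le_mul₀ (norm_nonneg _) hC.le (h m)

lemma opNorm_nonneg (f : BoundedMap R M N) : 0 ≤ opNorm f :=
  Real.iSup_nonneg fun _ => by positivity

lemma norm_apply_le (f : BoundedMap R M N) (m : M) : ‖f.1 m‖ ≤ opNorm f * ‖m‖ := by
  rcases eq_or_ne m 0 with rfl | hm
  · simp
  · have := le_ciSup (bddAbove_opNorm f) m
    rwa [div_le_iff₀ (norm_pos_iff.2 hm)] at this

lemma opNorm_le (f : BoundedMap R M N) {C : ℝ} (hC : 0 ≤ C) (h : ∀ m, ‖f.1 m‖ ≤ C * ‖m‖) :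
    opNorm f ≤ C :=
  ciSup_le fun m => div_le_of_le_mul₀ (norm_nonneg _) hC (h m)

noncomputable instance : NormedAddCommGroup (BoundedMap R M N) :=
  AddGroupNorm.toNormedAddCommGroup
    { toFun := opNorm
      map_zero' := le_antisymm (opNorm_le _ le_rfl fun m => by simp) (opNorm_nonneg _)
      add_le' := fun f g => opNorm_le _ (add_nonneg (opNorm_nonneg f) (opNorm_nonneg g)) fun m => by
        calc ‖f.1 m + g.1 m‖ ≤ ‖f.1 m‖ + ‖g.1 m‖ := norm_add_le _ _
          _ ≤ opNorm f * ‖m‖ + opNorm g * ‖m‖ := add_le_add (norm_apply_le f m) (norm_apply_le g m)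
          _ = (opNorm f + opNorm g) * ‖m‖ := by ring
      neg' := fun f => by simp [opNorm]
      eq_zero_of_map_eq_zero' := fun f hf => by
        ext m
        have := norm_apply_le f m
        rw [hf, zero_mul] at this
        simpa using this }

lemma norm_def (f : BoundedMap R M N) : ‖f‖ = ⨆ m : M, ‖f.1 m‖ / ‖m‖ := rfl

lemma le_norm (f : BoundedMap R M N) (m : M) : ‖f.1 m‖ ≤ ‖f‖ * ‖m‖ := norm_apply_le f m

lemma norm_le (f : BoundedMap R M N) {C : ℝ} (hC : 0 ≤ C) (h : ∀ m, ‖f.1 m‖ ≤ C * ‖m‖) :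
    ‖f‖ ≤ C := opNorm_le f hC h

instance : CompleteSpace (BoundedMap R M N) := by
  refine Metric.complete_of_cauchySeq_tendsto fun f hf => ?_
  have hpt : ∀ m, CauchySeq fun n => (f n).1 m := fun m => by
    rw [Metric.cauchySeq_iff] at hf ⊢
    intro ε hε
    obtain ⟨K, hK⟩ := hf (ε / (‖m‖ + 1)) (by positivity)
    refine ⟨K, fun i hi j hj => ?_⟩
    have h1 := hK i hi j hj
    rw [dist_eq_norm] at h1 ⊢
    have h2 := le_norm (f i - f j) m
    calc ‖(f i).1 m - (f j).1 m‖ ≤ ‖f i - f j‖ * ‖m‖ := h2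
      _ ≤ ‖f i - f j‖ * (‖m‖ + 1) := by gcongr; linarith
      _ < ε / (‖m‖ + 1) * (‖m‖ + 1) := by gcongr
      _ = ε := by field_simp
  choose g hg using fun m => cauchySeq_tendsto_of_complete (hpt m)
  obtain ⟨B, hB⟩ := hf.norm_bddAbove
  have hB' : ∀ n, ‖f n‖ ≤ B := fun n => hB ⟨n, rfl⟩
  have hB0 : 0 ≤ B := (norm_nonneg _).trans (hB' 0)
  have hsmul : ∀ (a : R), Continuous fun x : N => a • x := fun a => by
    obtain ⟨D, hD, h⟩ := BanachModule.exists_norm_smul_le (R := R) (M := N)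
    exact AddMonoidHomClass.continuous_of_bound (DistribSMul.toAddMonoidHom N a) (D * ‖a‖) (h a)
  let G : M →ₗ[R] N :=
    { toFun := g
      map_add' := fun x y => tendsto_nhds_unique (hg (x + y))
        (by simpa using (hg x).add (hg y))
      map_smul' := fun a x => tendsto_nhds_unique (hg (a • x))
        (by simpa [Function.comp_def] using ((hsmul a).tendsto _).comp (hg x)) }
  have hGle : ∀ m, ‖G m‖ ≤ (B + 1) * ‖m‖ := fun m =>
    le_of_tendsto (hg m).norm (Filter.Eventually.of_forall fun n =>
      (le_norm (f n) m).trans (by gcongr; linarith [hB' n]))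
  refine ⟨⟨G, B + 1, by positivity, hGle⟩, ?_⟩
  rw [Metric.tendsto_atTop]
  intro ε hε
  obtain ⟨K, hK⟩ := Metric.cauchySeq_iff.1 hf (ε / 2) (by positivity)
  refine ⟨K, fun n hn => ?_⟩
  rw [dist_eq_norm]
  refine lt_of_le_of_lt (norm_le _ (C := ε / 2) (by positivity) fun m => ?_) (by linarith)
  refine le_of_tendsto (((tendsto_const_nhds (x := (f n).1 m)).sub (hg m)).norm) ?_
  filter_upwards [Filter.eventually_ge_atTop K] with k hk
  have h1 := hK n hn k hk
  rw [dist_eq_norm] at h1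
  exact (le_norm (f n - f k) m).trans (by gcongr)

noncomputable instance : BanachModule R (BoundedMap R M N) where
  exists_norm_smul_le := by
    obtain ⟨D, hD, h⟩ := BanachModule.exists_norm_smul_le (R := R) (M := N)
    refine ⟨D, hD, fun a f => norm_le _ (by positivity) fun m => ?_⟩
    calc ‖a • f.1 m‖ ≤ D * ‖a‖ * ‖f.1 m‖ := h _ _
      _ ≤ D * ‖a‖ * (‖f‖ * ‖m‖) := by gcongr; exact le_norm f m
      _ = D * ‖a‖ * ‖f‖ * ‖m‖ := by ring
  complete := inferInstance

/-- The identity as a bounded map. -/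
def id : BoundedMap R M M := ⟨LinearMap.id, 1, one_pos, fun m => by simp⟩

/-- Composition of bounded maps. -/
def comp (g : BoundedMap R N P) (f : BoundedMap R M N) : BoundedMap R M P :=
  ⟨g.1 ∘ₗ f.1, by
    obtain ⟨C, hC, hf⟩ := f.2
    obtain ⟨D, hD, hg⟩ := g.2
    refine ⟨D * C, by positivity, fun m => ?_⟩
    calc ‖g.1 (f.1 m)‖ ≤ D * ‖f.1 m‖ := hg _
      _ ≤ D * (C * ‖m‖) := by gcongr; exact hf m
      _ = D * C * ‖m‖ := by ring⟩

/-- Post-composition with a bounded map, as a bounded map between internal Homs. -/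
noncomputable def postcomp (L : Type u) [NormedAddCommGroup L] [BanachModule R L]
    (f : BoundedMap R M N) : BoundedMap R (BoundedMap R L M) (BoundedMap R L N) :=
  ⟨{ toFun := fun T => comp f T
     map_add' := fun S T => Subtype.ext (LinearMap.comp_add _ _ _)
     map_smul' := fun a T => Subtype.ext (LinearMap.comp_smul _ _ _) },
   ‖f‖ + 1, by positivity, fun T => norm_le _ (by positivity) fun l => by
    calc ‖f.1 (T.1 l)‖ ≤ ‖f‖ * ‖T.1 l‖ := le_norm f _
      _ ≤ ‖f‖ * (‖T‖ * ‖l‖) := by gcongr; exact le_norm T l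
      _ ≤ (‖f‖ + 1) * ‖T‖ * ‖l‖ := by
        nlinarith [mul_nonneg (norm_nonneg T) (norm_nonneg l)]⟩

end BoundedMap

end InternalHom

/-! ### The completed projective tensor product -/

section Tensor

variable (R : Type u) [BanachRing R]
variable (M N : Type u) [NormedAddCommGroup M] [BanachModule R M]
  [NormedAddCommGroup N] [BanachModule R N]

/-- The algebraic tensor product, as a carrier for the projective seminorm. -/
def AlgTensor : Type u := M ⊗[R] N

namespace AlgTensor

noncomputable instance : AddCommGroup (AlgTensor R M N) :=
  inferInstanceAs (AddCommGroup (M ⊗[R] N))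

noncomputable instance : Module R (AlgTensor R M N) := inferInstanceAs (Module R (M ⊗[R] N))

variable {R M N}

/-- The pure tensor `m ⊗ n`. -/
noncomputable def tmul (m : M) (n : N) : AlgTensor R M N := (m ⊗ₜ[R] n : M ⊗[R] N)

/-- The values `∑ ‖m i‖ * ‖n i‖` over all finite representations `x = ∑ m i ⊗ n i`. -/
def costs (x : AlgTensor R M N) : Set ℝ :=
  {s | ∃ (k : ℕ) (m : Fin k → M) (n : Fin k → N),
    (∑ i, m i ⊗ₜ[R] n i : M ⊗[R] N) = x ∧ s = ∑ i, ‖m i‖ * ‖n i‖}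

lemma costs_nonneg {x : AlgTensor R M N} {s : ℝ} (hs : s ∈ costs x) : 0 ≤ s := by
  obtain ⟨k, m, n, -, rfl⟩ := hs
  positivity

lemma bddBelow_costs (x : AlgTensor R M N) : BddBelow (costs x) := ⟨0, fun _ => costs_nonneg⟩

lemma tmul_mem_costs (m : M) (n : N) : ‖m‖ * ‖n‖ ∈ costs (tmul (R := R) m n) :=
  ⟨1, fun _ => m, fun _ => n, by simp [tmul], by simp⟩

lemma zero_mem_costs : 0 ∈ costs (0 : AlgTensor R M N) :=
  ⟨0, Fin.elim0, Fin.elim0, by simp; rfl, by simp⟩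

lemma add_mem_costs {x y : AlgTensor R M N} {s t : ℝ} (hs : s ∈ costs x) (ht : t ∈ costs y) :
    s + t ∈ costs (x + y) := by
  obtain ⟨k, m, n, hx, rfl⟩ := hs
  obtain ⟨l, m', n', hy, rfl⟩ := ht
  refine ⟨k + l, Fin.append m m', Fin.append n n', ?_, ?_⟩
  · rw [Fin.sum_univ_add]
    simp only [Fin.append_left, Fin.append_right]
    rw [hx, hy]
    rfl
  · rw [Fin.sum_univ_add]
    simp

lemma neg_mem_costs {x : AlgTensor R M N} {s : ℝ} (hs : s ∈ costs x) : s ∈ costs (-x) := by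
  obtain ⟨k, m, n, hx, rfl⟩ := hs
  refine ⟨k, fun i => -m i, n, ?_, by simp⟩
  simp only [TensorProduct.neg_tmul, Finset.sum_neg_distrib]
  rw [hx]
  rfl

lemma induction_on {motive : AlgTensor R M N → Prop} (x : AlgTensor R M N) (zero : motive 0)
    (pure : ∀ m n, motive (tmul m n)) (add : ∀ x y, motive x → motive y → motive (x + y)) :
    motive x :=
  TensorProduct.induction_on (R := R) (M := M) (N := N) (motive := motive) x zero pure add

lemma costs_nonempty (x : AlgTensor R M N) : (costs x).Nonempty := by
  refine induction_on (motive := fun x => (costs x).Nonempty) x ⟨0, zero_mem_costs⟩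
    (fun m n => ⟨_, tmul_mem_costs m n⟩) ?_
  rintro x y ⟨s, hs⟩ ⟨t, ht⟩
  exact ⟨s + t, add_mem_costs hs ht⟩

/-- The projective seminorm `‖x‖ = inf {∑ ‖m i‖ * ‖n i‖ | x = ∑ m i ⊗ n i}`. -/
noncomputable instance : SeminormedAddCommGroup (AlgTensor R M N) :=
  AddGroupSeminorm.toSeminormedAddCommGroup
    { toFun := fun x => sInf (costs x)
      map_zero' := le_antisymm (csInf_le (bddBelow_costs _) zero_mem_costs)
        (Real.sInf_nonneg fun _ => costs_nonneg)
      add_le' := fun x y => by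
        refine le_of_forall_pos_le_add fun ε hε => ?_
        obtain ⟨s, hs, hs'⟩ := Real.lt_sInf_add_pos (costs_nonempty x) (half_pos hε)
        obtain ⟨t, ht, ht'⟩ := Real.lt_sInf_add_pos (costs_nonempty y) (half_pos hε)
        have := csInf_le (bddBelow_costs _) (add_mem_costs hs ht)
        linarith
      neg' := fun x => by
        congr 1
        ext s
        exact ⟨fun h => by simpa using neg_mem_costs h, neg_mem_costs⟩ }

lemma norm_def (x : AlgTensor R M N) : ‖x‖ = sInf (costs x) := rfl

lemma norm_le_of_mem {x : AlgTensor R M N} {s : ℝ} (hs : s ∈ costs x) : ‖x‖ ≤ s :=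
  csInf_le (bddBelow_costs x) hs

/-- An additive map which is bounded on pure tensors is bounded for the projective seminorm. -/
lemma bound_of_tmul {G : Type*} [SeminormedAddCommGroup G] (f : M ⊗[R] N →+ G) {C : ℝ}
    (hC : 0 ≤ C) (h : ∀ m n, ‖f (m ⊗ₜ[R] n)‖ ≤ C * (‖m‖ * ‖n‖)) (x : AlgTensor R M N) :
    ‖f x‖ ≤ C * ‖x‖ := by
  have key : ∀ s ∈ costs x, ‖f x‖ ≤ C * s := by
    rintro _ ⟨k, m, n, rfl, rfl⟩
    rw [map_sum, Finset.mul_sum]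
    exact (norm_sum_le _ _).trans (Finset.sum_le_sum fun i _ => h _ _)
  rcases hC.eq_or_lt with rfl | hC'
  · obtain ⟨s, hs⟩ := costs_nonempty x
    simpa using key s hs
  · rw [← div_le_iff₀' hC']
    exact le_csInf (costs_nonempty x) fun s hs => (div_le_iff₀' hC').2 (key s hs)

lemma exists_norm_smul_le :
    ∃ C : ℝ, 0 < C ∧ ∀ (a : R) (x : AlgTensor R M N), ‖a • x‖ ≤ C * ‖a‖ * ‖x‖ := by
  obtain ⟨C, hC, h⟩ := BanachModule.exists_norm_smul_le (R := R) (M := M)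
  refine ⟨C, hC, fun a x => ?_⟩
  refine bound_of_tmul (G := AlgTensor R M N) (DistribSMul.toAddMonoidHom (AlgTensor R M N) a)
    (by positivity) (fun m n => ?_) x
  refine (norm_le_of_mem (tmul_mem_costs (a • m) n)).trans ?_
  calc ‖a • m‖ * ‖n‖ ≤ C * ‖a‖ * ‖m‖ * ‖n‖ := by gcongr; exact h a m
    _ = C * ‖a‖ * (‖m‖ * ‖n‖) := by ring

instance : UniformContinuousConstSMul R (AlgTensor R M N) where
  uniformContinuous_const_smul a := by
    obtain ⟨C, hC, h⟩ := exists_norm_smul_le (R := R) (M := M) (N := N)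
    exact uniformContinuous_of_continuousAt_zero (DistribSMul.toAddMonoidHom (AlgTensor R M N) a)
      (AddMonoidHomClass.continuous_of_bound (DistribSMul.toAddMonoidHom (AlgTensor R M N) a)
        (C * ‖a‖) (h a)).continuousAt

end AlgTensor

/-- The projective tensor product `M ⊗̂_R N`: the separated completion of `M ⊗_R N` with respect to
the projective seminorm. -/
abbrev ProjTensor : Type u := UniformSpace.Completion (AlgTensor R M N)

noncomputable instance : BanachModule R (ProjTensor R M N) where
  exists_norm_smul_le := by
    obtain ⟨C, hC, h⟩ := AlgTensor.exists_norm_smul_le (R := R) (M := M) (N := N)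
    refine ⟨C, hC, fun a x => ?_⟩
    induction x using UniformSpace.Completion.induction_on with
    | hp => exact isClosed_le (continuous_norm.comp (continuous_const_smul a))
              (continuous_const.mul continuous_norm)
    | ih x =>
      rw [← UniformSpace.Completion.coe_smul, UniformSpace.Completion.norm_coe,
        UniformSpace.Completion.norm_coe]
      exact h a x
  complete := inferInstance

namespace ProjTensor

variable {M N}

/-- The pure tensor `m ⊗ n` in the completed tensor product. -/
noncomputable def tmul (m : M) (n : N) : ProjTensor R M N :=
  (AlgTensor.tmul m n : AlgTensor R M N)

lemma norm_tmul_le (m : M) (n : N) : ‖tmul R m n‖ ≤ ‖m‖ * ‖n‖ := by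
  rw [tmul, UniformSpace.Completion.norm_coe]
  exact AlgTensor.norm_le_of_mem (AlgTensor.tmul_mem_costs m n)

variable {R}
variable {P : Type u} [NormedAddCommGroup P] [BanachModule R P]

/-- The bounded map out of the completed tensor product that is induced by a bounded bilinear
map. -/
noncomputable def lift (B : M →ₗ[R] N →ₗ[R] P)
    (hB : ∃ C : ℝ, 0 < C ∧ ∀ m n, ‖B m n‖ ≤ C * (‖m‖ * ‖n‖)) :
    BoundedMap R (ProjTensor R M N) P :=
  have bound : ∃ C : ℝ, 0 < C ∧ ∀ x : AlgTensor R M N,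
      ‖(TensorProduct.lift B : M ⊗[R] N →ₗ[R] P) x‖ ≤ C * ‖x‖ := by
    obtain ⟨C, hC, h⟩ := hB
    exact ⟨C, hC, fun x => AlgTensor.bound_of_tmul (TensorProduct.lift B).toAddMonoidHom hC.le
      (fun m n => by simpa using h m n) x⟩
  let f : AlgTensor R M N →+ P := (TensorProduct.lift B : M ⊗[R] N →ₗ[R] P).toAddMonoidHom
  have hf : Continuous f := by
    obtain ⟨C, hC, h⟩ := bound
    exact AddMonoidHomClass.continuous_of_bound f C h
  have hsmul : ∀ a : R, Continuous fun p : P => a • p := fun a => by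
    obtain ⟨D, hD, h⟩ := BanachModule.exists_norm_smul_le (R := R) (M := P)
    exact AddMonoidHomClass.continuous_of_bound (DistribSMul.toAddMonoidHom P a) (D * ‖a‖) (h a)
  ⟨{ (f.extension hf : ProjTensor R M N →+ P) with
     map_smul' := fun a x => by
      change f.extension hf (a • x) = a • f.extension hf x
      induction x using UniformSpace.Completion.induction_on with
      | hp =>
        exact isClosed_eq ((f.continuous_extension hf).comp (continuous_const_smul a))
          ((hsmul a).comp (f.continuous_extension hf))
      | ih x =>
        rw [← UniformSpace.Completion.coe_smul, f.extension_coe hf, f.extension_coe hf]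
        exact (TensorProduct.lift B : M ⊗[R] N →ₗ[R] P).map_smul a x }, by
    obtain ⟨C, hC, h⟩ := bound
    refine ⟨C, hC, fun x => ?_⟩
    change ‖f.extension hf x‖ ≤ C * ‖x‖
    induction x using UniformSpace.Completion.induction_on with
    | hp => exact isClosed_le (continuous_norm.comp (f.continuous_extension hf))
              (continuous_const.mul continuous_norm)
    | ih x =>
      rw [f.extension_coe hf, UniformSpace.Completion.norm_coe]
      exact h x⟩

@[simp]
lemma lift_tmul (B : M →ₗ[R] N →ₗ[R] P)
    (hB : ∃ C : ℝ, 0 < C ∧ ∀ m n, ‖B m n‖ ≤ C * (‖m‖ * ‖n‖)) (m : M) (n : N) :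
    (lift B hB).1 (tmul R m n) = B m n := by
  obtain ⟨C, hC, h⟩ := hB
  have h' : ∀ x : AlgTensor R M N, ‖(TensorProduct.lift B).toAddMonoidHom x‖ ≤ C * ‖x‖ :=
    fun x => AlgTensor.bound_of_tmul (TensorProduct.lift B).toAddMonoidHom hC.le
      (fun m n => by simpa using h m n) x
  let f : AlgTensor R M N →+ P := (TensorProduct.lift B : M ⊗[R] N →ₗ[R] P).toAddMonoidHom
  have h1 : f (AlgTensor.tmul m n) = B m n := TensorProduct.lift.tmul m n
  exact (f.extension_coe (AddMonoidHomClass.continuous_of_bound f C h') (AlgTensor.tmul m n)).trans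
    h1

/-- Bounded maps out of the completed tensor product are determined by their values on pure
tensors. -/
lemma hom_ext {f g : BoundedMap R (ProjTensor R M N) P}
    (h : ∀ m n, f.1 (tmul R m n) = g.1 (tmul R m n)) : f = g := by
  have hc : ∀ f : BoundedMap R (ProjTensor R M N) P, Continuous f.1 := fun f => by
    obtain ⟨C, -, hC⟩ := f.2
    exact AddMonoidHomClass.continuous_of_bound f.1 C hC
  ext x
  induction x using UniformSpace.Completion.induction_on with
  | hp => exact isClosed_eq (hc f) (hc g)
  | ih x =>
    refine AlgTensor.induction_on (motive := fun x => f.1 (x : ProjTensor R M N) =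
        g.1 (x : ProjTensor R M N)) x ?_ h ?_
    · exact (map_zero f.1).trans (map_zero g.1).symm
    · intro x y hx hy
      rw [UniformSpace.Completion.coe_add, map_add, map_add, hx, hy]

variable (R) in
/-- The universal bounded bilinear map. -/
noncomputable def mk : M →ₗ[R] N →ₗ[R] ProjTensor R M N :=
  LinearMap.mk₂ R (tmul R)
    (fun m m' n => by
      simp only [tmul, ← UniformSpace.Completion.coe_add]
      exact congrArg _ (TensorProduct.add_tmul m m' n))
    (fun a m n => by
      simp only [tmul, ← UniformSpace.Completion.coe_smul]
      exact congrArg _ (TensorProduct.smul_tmul' a m n).symm)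
    (fun m n n' => by
      simp only [tmul, ← UniformSpace.Completion.coe_add]
      exact congrArg _ (TensorProduct.tmul_add m n n'))
    (fun a m n => by
      simp only [tmul, ← UniformSpace.Completion.coe_smul]
      exact congrArg _ (TensorProduct.tmul_smul a m n))

/-- The bounded map `id ⊗̂ f`. -/
noncomputable def lTensor (M : Type u) [NormedAddCommGroup M] [BanachModule R M]
    (f : BoundedMap R N P) : BoundedMap R (ProjTensor R M N) (ProjTensor R M P) :=
  lift ((mk R).compl₂ f.1) ⟨‖f‖ + 1, by positivity, fun m n => by
    calc ‖tmul R m (f.1 n)‖ ≤ ‖m‖ * ‖f.1 n‖ := norm_tmul_le R _ _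
      _ ≤ ‖m‖ * (‖f‖ * ‖n‖) := by gcongr; exact BoundedMap.le_norm f n
      _ ≤ (‖f‖ + 1) * (‖m‖ * ‖n‖) := by
        nlinarith [mul_nonneg (norm_nonneg m) (norm_nonneg n)]⟩

@[simp]
lemma lTensor_tmul (f : BoundedMap R N P) (m : M) (n : N) :
    (lTensor M f).1 (tmul R m n) = tmul R m (f.1 n) :=
  lift_tmul _ _ _ _

lemma lTensor_id : lTensor M (BoundedMap.id : BoundedMap R N N) = BoundedMap.id :=
  hom_ext fun _ _ => lTensor_tmul _ _ _

lemma lTensor_comp {Q : Type u} [NormedAddCommGroup Q] [BanachModule R Q]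
    (g : BoundedMap R P Q) (f : BoundedMap R N P) :
    lTensor M (g.comp f) = (lTensor M g).comp (lTensor M f) :=
  hom_ext fun m n => by
    change _ = (lTensor M g).1 ((lTensor M f).1 (tmul R m n))
    rw [lTensor_tmul, lTensor_tmul, lTensor_tmul]
    rfl

/-- The canonical map `Hom(M, R) ⊗̂ N → Hom(M, N)`, `α ⊗ n ↦ (m ↦ α(m) n)`. -/
noncomputable def dualToHom (M N : Type u) [NormedAddCommGroup M] [BanachModule R M]
    [NormedAddCommGroup N] [BanachModule R N] :
    BoundedMap R (ProjTensor R (BoundedMap R M R) N) (BoundedMap R M N) :=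
  have bound : ∃ C : ℝ, 0 < C ∧ ∀ (α : BoundedMap R M R) (n : N) (m : M),
      ‖α.1 m • n‖ ≤ C * (‖α‖ * ‖n‖) * ‖m‖ := by
    obtain ⟨C, hC, h⟩ := BanachModule.exists_norm_smul_le (R := R) (M := N)
    refine ⟨C, hC, fun α n m => ?_⟩
    calc ‖α.1 m • n‖ ≤ C * ‖α.1 m‖ * ‖n‖ := h _ _
      _ ≤ C * (‖α‖ * ‖m‖) * ‖n‖ := by gcongr; exact BoundedMap.le_norm α m
      _ = C * (‖α‖ * ‖n‖) * ‖m‖ := by ring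
  lift
    (LinearMap.mk₂ R
      (fun α n => ⟨LinearMap.smulRight α.1 n, by
        obtain ⟨C, hC, h⟩ := bound
        exact ⟨C * (‖α‖ * ‖n‖) + 1, by positivity, fun m =>
          (h α n m).trans (by gcongr; linarith)⟩⟩)
      (fun α β n => Subtype.ext (LinearMap.ext fun m => add_smul _ _ _))
      (fun a α n => Subtype.ext (LinearMap.ext fun m => smul_assoc a (α.1 m) n))
      (fun α n n' => Subtype.ext (LinearMap.ext fun m => smul_add _ _ _))
      (fun a α n => Subtype.ext (LinearMap.ext fun m => smul_comm _ _ _)))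
    (by
      obtain ⟨C, hC, h⟩ := bound
      exact ⟨C, hC, fun α n => BoundedMap.norm_le _ (by positivity) (h α n)⟩)

@[simp]
lemma dualToHom_tmul_apply (α : BoundedMap R M R) (n : N) (m : M) :
    ((dualToHom M N).1 (tmul R α n)).1 m = α.1 m • n := by
  rw [dualToHom, lift_tmul]
  rfl

lemma dualToHom_natural (f : BoundedMap R N P) :
    (dualToHom M P).comp (lTensor (BoundedMap R M R) f) =
      (BoundedMap.postcomp M f).comp (dualToHom M N) :=
  hom_ext fun α n => Subtype.ext (LinearMap.ext fun m => by
    change ((dualToHom M P).1 ((lTensor (BoundedMap R M R) f).1 (tmul R α n))).1 m =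
      f.1 (((dualToHom M N).1 (tmul R α n)).1 m)
    rw [lTensor_tmul, dualToHom_tmul_apply, dualToHom_tmul_apply, map_smul])

end ProjTensor

end Tensor

/-! ### The category `Ban R` with its tensor product and internal Hom -/

/-- The category of Banach modules over `R` and bounded `R`-linear maps. -/
structure Ban (R : Type u) [BanachRing R] : Type (u + 1) where
  of ::
  carrier : Type u
  [normedAddCommGroup : NormedAddCommGroup carrier]
  [banachModule : BanachModule R carrier]

namespace Ban

attribute [instance] Ban.normedAddCommGroup Ban.banachModule

variable {R : Type u} [BanachRing R]

/-- Morphisms of Banach modules are the bounded linear maps. -/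
@[ext]
structure Hom (V W : Ban R) : Type u where
  toMap : BoundedMap R V.carrier W.carrier

noncomputable instance : Category.{u} (Ban R) where
  Hom := Hom
  id V := ⟨BoundedMap.id⟩
  comp f g := ⟨g.toMap.comp f.toMap⟩

lemma hom_ext' {V W : Ban R} {f g : V ⟶ W} (h : ∀ v, f.toMap.1 v = g.toMap.1 v) : f = g :=
  Hom.ext (Subtype.ext (LinearMap.ext h))

@[simp] lemma id_apply {V : Ban R} (v : V.carrier) : (Hom.toMap (𝟙 V)).1 v = v := rfl

@[simp] lemma comp_apply {U V W : Ban R} (f : U ⟶ V) (g : V ⟶ W) (v : U.carrier) :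
    (Hom.toMap (f ≫ g)).1 v = g.toMap.1 (f.toMap.1 v) := rfl

/-- The functor `U ⊗̂_R (-)` on Banach modules. -/
noncomputable def tensor (U : Ban R) : Ban R ⥤ Ban R where
  obj V := of (ProjTensor R U.carrier V.carrier)
  map f := ⟨ProjTensor.lTensor U.carrier f.toMap⟩
  map_id _ := Hom.ext ProjTensor.lTensor_id
  map_comp f g := Hom.ext (ProjTensor.lTensor_comp g.toMap f.toMap)

/-- The internal Hom functor `Hom(W, -)` on Banach modules. -/
noncomputable def internalHom (W : Ban R) : Ban R ⥤ Ban R where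
  obj V := of (BoundedMap R W.carrier V.carrier)
  map f := ⟨BoundedMap.postcomp W.carrier f.toMap⟩

variable (R) in
/-- The unit object `R`. -/
noncomputable def unit : Ban R := of R

/-- The dual `W^∨ = Hom(W, R)`. -/
noncomputable def dual (W : Ban R) : Ban R := (internalHom W).obj (unit R)

/-- The canonical morphism `W^∨ ⊗̂ V ⟶ Hom(W, V)`, `α ⊗ v ↦ (w ↦ α(w) v)`, natural in `V`. -/
noncomputable def dualTensorToHom (W : Ban R) : tensor W.dual ⟶ internalHom W where
  app V := ⟨ProjTensor.dualToHom W.carrier V.carrier⟩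
  naturality _ _ f := Hom.ext (ProjTensor.dualToHom_natural f.toMap)

end Ban

/-! ### Extension of functors to Ind-categories -/

namespace IndExt

universe v w

variable {C : Type w} [Category.{v} C]

lemma isFiltered_finallySmall (V : Ind C) :
    IsFiltered (CostructuredArrow (Ind.yoneda (C := C)) V) ∧
      FinallySmall.{v} (CostructuredArrow (Ind.yoneda (C := C)) V) := by
  obtain ⟨h₁, h₂⟩ := (isIndObject_iff _).1 (Ind.isIndObject_inclusion_obj V)
  let e := ((CostructuredArrow.post Ind.yoneda (Ind.inclusion C) V).asEquivalence.trans
      (CostructuredArrow.mapNatIso Ind.yonedaCompInclusion)).symm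
  exact ⟨IsFiltered.of_equivalence e, finallySmall_of_final_of_finallySmall e.functor⟩

instance hasColimits (V : Ind C) (D : Type*) [Category D] [HasFilteredColimitsOfSize.{v, v} D] :
    HasColimitsOfShape (CostructuredArrow (Ind.yoneda (C := C)) V) D := by
  obtain ⟨h₁, h₂⟩ := isFiltered_finallySmall V
  exact Functor.Final.hasColimitsOfShape_of_final (FinallySmall.fromFilteredFinalModel.{v} _)

/-- The extension of an endofunctor `F` of `C` to `Ind C`, sending `“colim” V_j` to
`“colim” F(V_j)`: at `V` it is the colimit in `Ind C` of `F(X)` over the filtered category of all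
`X ⟶ V` with `X` in `C`. -/
noncomputable def extend (F : C ⥤ C) : Ind C ⥤ Ind C :=
  (Ind.yoneda (C := C)).pointwiseLeftKanExtension (F ⋙ Ind.yoneda)

/-- The coprojection `F(X) ⟶ extend F V` at an object `X ⟶ V` of the indexing category. -/
noncomputable def extendι (F : C ⥤ C) {V : Ind C}
    (j : CostructuredArrow (Ind.yoneda (C := C)) V) :
    Ind.yoneda.obj (F.obj j.left) ⟶ (extend F).obj V :=
  colimit.ι (CostructuredArrow.proj Ind.yoneda V ⋙ F ⋙ Ind.yoneda) j

lemma extendι_map (F : C ⥤ C) {V V' : Ind C} (f : V ⟶ V')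
    (j : CostructuredArrow (Ind.yoneda (C := C)) V) :
    extendι F j ≫ (extend F).map f = extendι F ((CostructuredArrow.map f).obj j) :=
  colimit.ι_desc _ _

/-- The value at `V` of the extension to `Ind C` of a natural transformation. -/
noncomputable def extendMapApp {F G : C ⥤ C} (τ : F ⟶ G) (V : Ind C) :
    (extend F).obj V ⟶ (extend G).obj V :=
  colimMap (Functor.whiskerLeft (CostructuredArrow.proj Ind.yoneda V)
    (Functor.whiskerRight τ Ind.yoneda))

lemma extendι_mapApp {F G : C ⥤ C} (τ : F ⟶ G) {V : Ind C}
    (j : CostructuredArrow (Ind.yoneda (C := C)) V) :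
    extendι F j ≫ extendMapApp τ V = Ind.yoneda.map (τ.app j.left) ≫ extendι G j :=
  ι_colimMap _ _

/-- The extension to `Ind C` of a natural transformation, sending `“colim” V_j` to
`“colim” τ(V_j)`. -/
noncomputable def extendMap {F G : C ⥤ C} (τ : F ⟶ G) : extend F ⟶ extend G where
  app V := extendMapApp τ V
  naturality V V' f := colimit.hom_ext fun j => by
    change extendι F j ≫ (extend F).map f ≫ extendMapApp τ V' =
      extendι F j ≫ extendMapApp τ V ≫ (extend G).map f
    calc extendι F j ≫ (extend F).map f ≫ extendMapApp τ V'
        = (extendι F j ≫ (extend F).map f) ≫ extendMapApp τ V' := (Category.assoc _ _ _).symm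
      _ = Ind.yoneda.map (τ.app j.left) ≫ extendι G ((CostructuredArrow.map f).obj j) := by
        rw [extendι_map, extendι_mapApp]; rfl
      _ = Ind.yoneda.map (τ.app j.left) ≫ extendι G j ≫ (extend G).map f := by rw [extendι_map]
      _ = (extendι F j ≫ extendMapApp τ V) ≫ (extend G).map f := by
        rw [extendι_mapApp, Category.assoc]
      _ = _ := Category.assoc _ _ _

end IndExt

/-! ### Nuclear objects of `Ind(Ban R)` -/

namespace IndBan

variable {R : Type u} [BanachRing R]

/-- The functor `U ⊗̂_R (-)` on `Ind(Ban R)` for a Banach module `U`. -/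
noncomputable def tensor (U : Ban R) : Ind (Ban R) ⥤ Ind (Ban R) := IndExt.extend U.tensor

/-- The internal Hom functor `Hom(W, -)` on `Ind(Ban R)` for a Banach module `W`. -/
noncomputable def internalHom (W : Ban R) : Ind (Ban R) ⥤ Ind (Ban R) :=
  IndExt.extend W.internalHom

/-- The natural morphism `W^∨ ⊗̂ V ⟶ Hom(W, V)` for a Banach module `W` and `V` in `Ind(Ban R)`. -/
noncomputable def dualTensorToHom (W : Ban R) : tensor W.dual ⟶ internalHom W :=
  IndExt.extendMap W.dualTensorToHom

/-- An object `V` of `Ind(Ban R)` is nuclear if `W^∨ ⊗̂ V ⟶ Hom(W, V)` is an isomorphism for every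
Banach module `W`. -/
def IsNuclear (V : Ind (Ban R)) : Prop := ∀ W : Ban R, IsIso ((dualTensorToHom W).app V)

end IndBan

/-! Call a map `X ⟶ Y` of Banach modules trace class if it comes from an element of `X^∨ ⊗̂ Y`. The
proof rests on `IndBan.isNuclear_iff`: `V` is nuclear exactly when every map from a Banach module to
`V` factors through a trace class map. For nuclear `V`, such a factorization is found by lifting the
identity of `X`, seen as a section of `Hom(X, X)`. Conversely, a tensor `t` over `φ : X ⟶ Y` yields
`Hom(W, X) ⟶ W^∨ ⊗̂ Y`, `h ↦ t ∘ h`, which inverts the canonical map up to `φ`; in the filtered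
colimit this is a true inverse.

Products. A family of bounded maps `X ⟶ M i` need not be uniformly bounded, but it lands in a
weighted `ℓ^∞`-product once the weights dominate the norms. So the presheaf product of
representables is the filtered union of the weighted products over all `w : ι → ℕ`, and `Ind (Ban
R)` has small products (`Ban.isIndObject_pi_yoneda`). The constants of scalar multiplication may be
unbounded along the family, so each `M i` is replaced by the isomorphic module `Hom(R, M i)`, whose
constant depends on `R` only. If the components of a map to a countable product factor through
tensors `t i`, then for rapidly growing weights the sum of the `t i` converges in the tensor product
with the weighted product, and it represents a trace class factorization of the whole map.

Coproducts. Since `Ban R` is additive, finite coproducts of ind-objects are finite products, hence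
nuclear. An arbitrary coproduct is the filtered colimit of the finite ones, and a map from a Banach
module factors through one of these because representables are compact in the ind-category. -/

namespace BoundedMap

/-! ### Bounded maps and the renorming `M ≅ Hom(R, M)`. -/

variable {R : Type u} [BanachRing R]
variable {M N P : Type u} [NormedAddCommGroup M] [BanachModule R M]
  [NormedAddCommGroup N] [BanachModule R N] [NormedAddCommGroup P] [BanachModule R P]

lemma continuous (f : BoundedMap R M N) : Continuous f.1 :=
  AddMonoidHomClass.continuous_of_bound f.1 ‖f‖ (le_norm f)

lemma norm_comp_le (g : BoundedMap R N P) (f : BoundedMap R M N) : ‖comp g f‖ ≤ ‖g‖ * ‖f‖ :=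
  norm_le _ (by positivity) fun m => by
    calc ‖g.1 (f.1 m)‖ ≤ ‖g‖ * ‖f.1 m‖ := le_norm g _
      _ ≤ ‖g‖ * (‖f‖ * ‖m‖) := by gcongr; exact le_norm f m
      _ = ‖g‖ * ‖f‖ * ‖m‖ := by ring

/-- Pre-composition with a bounded map, as a bounded map between internal Homs. -/
noncomputable def precomp (P : Type u) [NormedAddCommGroup P] [BanachModule R P]
    (f : BoundedMap R M N) : BoundedMap R (BoundedMap R N P) (BoundedMap R M P) :=
  ⟨{ toFun := fun T => comp T f
     map_add' := fun S T => Subtype.ext (LinearMap.add_comp _ _ _)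
     map_smul' := fun a T => Subtype.ext (LinearMap.smul_comp _ _ _) },
   ‖f‖ + 1, by positivity, fun T => (norm_comp_le T f).trans (by
     nlinarith [norm_nonneg T, norm_nonneg f])⟩

/-- Scalar multiplication `m ↦ (r ↦ r • m)`, as a bounded map `M → Hom(R, M)`. -/
noncomputable def toHomRing (M : Type u) [NormedAddCommGroup M] [BanachModule R M] :
    BoundedMap R M (BoundedMap R R M) :=
  have bound : ∃ C : ℝ, 0 < C ∧ ∀ (m : M) (r : R), ‖r • m‖ ≤ C * ‖m‖ * ‖r‖ := by
    obtain ⟨C, hC, h⟩ := BanachModule.exists_norm_smul_le (R := R) (M := M)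
    exact ⟨C, hC, fun m r => (h r m).trans (by nlinarith)⟩
  ⟨{ toFun := fun m => ⟨LinearMap.toSpanSingleton R M m, by
        obtain ⟨C, hC, h⟩ := bound
        exact ⟨C * ‖m‖ + 1, by positivity, fun r => (h m r).trans (by gcongr; linarith)⟩⟩
     map_add' := fun m m' => Subtype.ext (LinearMap.ext fun r => smul_add r m m')
     map_smul' := fun a m => Subtype.ext (LinearMap.ext fun r => smul_comm r a m) }, by
    obtain ⟨C, hC, h⟩ := bound
    exact ⟨C, hC, fun m => norm_le _ (by positivity) (h m)⟩⟩

lemma toHomRing_apply (m : M) (r : R) : ((toHomRing (R := R) M).1 m).1 r = r • m := rfl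

/-- Evaluation at `m`, as a bounded map. -/
noncomputable def evalAt (N : Type u) [NormedAddCommGroup N] [BanachModule R N] (m : M) :
    BoundedMap R (BoundedMap R M N) N :=
  ⟨{ toFun := fun f => f.1 m
     map_add' := fun _ _ => rfl
     map_smul' := fun _ _ => rfl },
   ‖m‖ + 1, by positivity, fun f => (le_norm f m).trans (by
     nlinarith [norm_nonneg f, norm_nonneg m])⟩

variable (R) in
/-- Unlike a general Banach module, `Hom(R, M)` has scalar multiplication bounded by a constant
that depends on `R` only. -/
lemma exists_norm_smul_homRing_le : ∃ C : ℝ, 0 < C ∧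
    ∀ (M : Type u) [NormedAddCommGroup M] [BanachModule R M] (a : R) (f : BoundedMap R R M),
      ‖a • f‖ ≤ C * ‖a‖ * ‖f‖ := by
  obtain ⟨C, hC, h⟩ := BanachRing.exists_norm_mul_le (R := R)
  refine ⟨C, hC, fun M _ _ a f => norm_le _ (by positivity) fun r => ?_⟩
  calc ‖a • f.1 r‖ = ‖f.1 (a * r)‖ := by rw [← smul_eq_mul, map_smul]
    _ ≤ ‖f‖ * ‖a * r‖ := le_norm f _
    _ ≤ ‖f‖ * (C * ‖a‖ * ‖r‖) := by gcongr; exact h a r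
    _ = C * ‖a‖ * ‖f‖ * ‖r‖ := by ring

end BoundedMap

/-! ### Tensors in `X^∨ ⊗̂ Y` as trace class maps. -/

namespace ProjTensor

variable {R : Type u} [BanachRing R]
variable {M N P W : Type u} [NormedAddCommGroup M] [BanachModule R M]
  [NormedAddCommGroup N] [BanachModule R N] [NormedAddCommGroup P] [BanachModule R P]
  [NormedAddCommGroup W] [BanachModule R W]

lemma induction_on {p : ProjTensor R M N → Prop} (hp : IsClosed {x | p x})
    (tmul : ∀ m n, p (tmul R m n)) (add : ∀ x y, p x → p y → p (x + y))
    (x : ProjTensor R M N) : p x := by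
  induction x using UniformSpace.Completion.induction_on with
  | hp => exact hp
  | ih x =>
    refine AlgTensor.induction_on (motive := fun x => p (x : ProjTensor R M N)) x ?_ tmul ?_
    · have := tmul 0 0
      simp only [ProjTensor.tmul, AlgTensor.tmul, TensorProduct.zero_tmul] at this
      exact this
    · intro x y hx hy
      rw [UniformSpace.Completion.coe_add]
      exact add _ _ hx hy

/-- The factor is `‖f‖` itself, not the `‖f‖ + 1` used to construct `lTensor`: the convergence
argument needs maps of small norm to give small tensors. -/
lemma norm_lTensor_apply_le (f : BoundedMap R N P) (t : ProjTensor R M N) :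
    ‖(lTensor M f).1 t‖ ≤ ‖f‖ * ‖t‖ := by
  induction t using UniformSpace.Completion.induction_on with
  | hp => exact isClosed_le (continuous_norm.comp (lTensor M f).continuous)
            (continuous_const.mul continuous_norm)
  | ih t =>
    rw [UniformSpace.Completion.norm_coe]
    let g : M ⊗[R] N →+ ProjTensor R M P :=
      { toFun := fun t => (lTensor M f).1 ((show AlgTensor R M N from t : ProjTensor R M N))
        map_zero' := map_zero (lTensor M f).1
        map_add' := fun x y =>
          (congrArg (lTensor M f).1
            (UniformSpace.Completion.coe_add (α := AlgTensor R M N) x y)).trans (map_add (lTensor M f).1 _ _) }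
    refine AlgTensor.bound_of_tmul g (norm_nonneg f) (fun m n => ?_) t
    calc ‖(lTensor M f).1 (tmul R m n)‖ = ‖tmul R m (f.1 n)‖ := by rw [lTensor_tmul]
      _ ≤ ‖m‖ * ‖f.1 n‖ := norm_tmul_le R _ _
      _ ≤ ‖m‖ * (‖f‖ * ‖n‖) := by gcongr; exact BoundedMap.le_norm f n
      _ = ‖f‖ * (‖m‖ * ‖n‖) := by ring

/-- The bounded map `Hom(M, R) ⊗̂ N → Hom(Hom(W, M), Hom(W, R) ⊗̂ N)`,
`ξ ⊗ n ↦ (h ↦ (ξ ∘ h) ⊗ n)`. -/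
noncomputable def pullback (W M N : Type u) [NormedAddCommGroup M] [BanachModule R M]
    [NormedAddCommGroup N] [BanachModule R N] [NormedAddCommGroup W] [BanachModule R W] :
    BoundedMap R (ProjTensor R (BoundedMap R M R) N)
      (BoundedMap R (BoundedMap R W M) (ProjTensor R (BoundedMap R W R) N)) :=
  have bound : ∀ (ξ : BoundedMap R M R) (n : N) (h : BoundedMap R W M),
      ‖tmul R (ξ.comp h) n‖ ≤ ‖ξ‖ * ‖n‖ * ‖h‖ := fun ξ n h => by
    calc ‖tmul R (ξ.comp h) n‖ ≤ ‖ξ.comp h‖ * ‖n‖ := norm_tmul_le R _ _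
      _ ≤ ‖ξ‖ * ‖h‖ * ‖n‖ := by gcongr; exact BoundedMap.norm_comp_le ξ h
      _ = ‖ξ‖ * ‖n‖ * ‖h‖ := by ring
  lift
    (LinearMap.mk₂ R
      (fun ξ n => ⟨((mk R).flip n) ∘ₗ (BoundedMap.postcomp W ξ).1, ‖ξ‖ * ‖n‖ + 1, by positivity,
        fun h => (bound ξ n h).trans (by gcongr; linarith)⟩)
      (fun ξ ξ' n => Subtype.ext (LinearMap.ext fun h =>
        (congrArg ((mk R).flip n) (Subtype.ext (LinearMap.add_comp _ _ _))).trans (map_add _ _ _)))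
      (fun a ξ n => Subtype.ext (LinearMap.ext fun h =>
        (congrArg ((mk R).flip n) (Subtype.ext (LinearMap.smul_comp _ _ _))).trans
          (map_smul ((mk R).flip n) a (ξ.comp h))))
      (fun ξ n n' => Subtype.ext (LinearMap.ext fun h => map_add (mk R (ξ.comp h)) n n'))
      (fun a ξ n => Subtype.ext (LinearMap.ext fun h => map_smul (mk R (ξ.comp h)) a n)))
    ⟨1, one_pos, fun ξ n => BoundedMap.norm_le _ (by positivity) fun h => by
      rw [one_mul]
      exact bound ξ n h⟩

lemma pullback_tmul_apply (ξ : BoundedMap R M R) (n : N) (h : BoundedMap R W M) :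
    ((pullback W M N).1 (tmul R ξ n)).1 h = tmul R (ξ.comp h) n := by
  rw [pullback, lift_tmul]
  rfl

/-- One half of the statement that `pullback t` inverts the canonical map up to the trace class map
of `t`: followed by the canonical map, it is post-composition with that map. -/
lemma dualToHom_pullback (t : ProjTensor R (BoundedMap R M R) N) (h : BoundedMap R W M) :
    (dualToHom W N).1 (((pullback W M N).1 t).1 h) = ((dualToHom M N).1 t).comp h := by
  change ((dualToHom W N).comp ((BoundedMap.evalAt _ h).comp (pullback W M N))).1 t =
    ((BoundedMap.precomp N h).comp (dualToHom M N)).1 t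
  congr 2
  refine hom_ext fun ξ n => Subtype.ext (LinearMap.ext fun w => ?_)
  change ((dualToHom W N).1 (((pullback W M N).1 (tmul R ξ n)).1 h)).1 w =
    ((dualToHom M N).1 (tmul R ξ n)).1 (h.1 w)
  rw [pullback_tmul_apply, dualToHom_tmul_apply, dualToHom_tmul_apply]
  rfl

/-- The other half. Both sides are bounded and linear in `z` and in `t`, so pure tensors suffice in
each variable. -/
lemma pullback_dualToHom (t : ProjTensor R (BoundedMap R M R) N)
    (z : ProjTensor R (BoundedMap R W R) M) :
    ((pullback W M N).1 t).1 ((dualToHom W M).1 z) =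
      (lTensor (BoundedMap R W R) ((dualToHom M N).1 t)).1 z := by
  change (((pullback W M N).1 t).comp (dualToHom W M)).1 z = _
  congr 2
  refine hom_ext fun α m => ?_
  rw [lTensor_tmul]
  change ((BoundedMap.evalAt _ ((dualToHom W M).1 (tmul R α m))).comp (pullback W M N)).1 t =
    (mk R α) (((BoundedMap.evalAt _ m).comp (dualToHom M N)).1 t)
  induction t using induction_on with
  | hp =>
    refine isClosed_eq (BoundedMap.continuous _) (Continuous.comp ?_ (BoundedMap.continuous _))
    exact AddMonoidHomClass.continuous_of_bound (mk R α) ‖α‖ fun n => norm_tmul_le R α n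
  | add x y hx hy => rw [map_add, map_add, map_add, hx, hy]
  | tmul ξ n =>
    change ((pullback W M N).1 (tmul R ξ n)).1 _ =
      (mk R α) (((dualToHom M N).1 (tmul R ξ n)).1 m)
    rw [pullback_tmul_apply, dualToHom_tmul_apply, map_smul]
    -- The scalar `ξ m` moves across the tensor to `α`, and `ξ m • α` is the composite of `ξ` with
    -- `w ↦ α w • m`.
    change _ = ξ.1 m • (mk R).flip n α
    rw [← map_smul]
    refine congrArg ((mk R).flip n) (Subtype.ext (LinearMap.ext fun w => ?_))
    change ξ.1 (((dualToHom W M).1 (tmul R α m)).1 w) = ξ.1 m * α.1 w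
    rw [dualToHom_tmul_apply, map_smul, smul_eq_mul, mul_comm]

end ProjTensor

/-! ### Weighted `ℓ^∞`-products of Banach modules. -/

namespace Ban

variable {R : Type u} [BanachRing R]

section WeightedProduct

variable {ι : Type u} (w : ι → ℕ) (M : ι → Ban R)

/-- The families `y i ∈ Hom(R, M i)` such that `‖y i‖ / (w i + 1)` is bounded. -/
def boundedFamilies : Submodule R (∀ i, BoundedMap R R (M i).carrier) where
  -- The weight is `w i + 1`, so that it is positive for every natural `w i`, and `w = 0` gives the
  -- plain sup norm.
  carrier := {y | ∃ C : ℝ, 0 ≤ C ∧ ∀ i, ‖y i‖ ≤ C * (w i + 1)}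
  add_mem' := by
    rintro y z ⟨C, hC, hy⟩ ⟨D, hD, hz⟩
    exact ⟨C + D, by positivity, fun i => (norm_add_le _ _).trans (by linarith [hy i, hz i])⟩
  zero_mem' := ⟨0, le_rfl, fun i => by simp⟩
  smul_mem' := by
    rintro a y ⟨C, hC, hy⟩
    obtain ⟨D, hD, h⟩ := BoundedMap.exists_norm_smul_homRing_le R
    refine ⟨D * ‖a‖ * C, by positivity, fun i => ?_⟩
    calc ‖a • y i‖ ≤ D * ‖a‖ * ‖y i‖ := h _ a (y i)
      _ ≤ D * ‖a‖ * (C * (w i + 1)) := by gcongr; exact hy i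
      _ = D * ‖a‖ * C * (w i + 1) := by ring

/-- The weighted `ℓ^∞`-product of the modules `Hom(R, M i) ≅ M i`. -/
def WeightedProd : Type u := boundedFamilies w M

namespace WeightedProd

instance : AddCommGroup (WeightedProd w M) := inferInstanceAs (AddCommGroup (boundedFamilies w M))

instance : Module R (WeightedProd w M) := inferInstanceAs (Module R (boundedFamilies w M))

variable {w M}

/-- The weighted supremum norm. -/
noncomputable def supNorm (y : WeightedProd w M) : ℝ := ⨆ i, ‖y.1 i‖ / (w i + 1)

lemma supNorm_nonneg (y : WeightedProd w M) : 0 ≤ supNorm y :=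
  Real.iSup_nonneg fun _ => by positivity

lemma norm_apply_le_supNorm (y : WeightedProd w M) (i : ι) :
    ‖y.1 i‖ ≤ supNorm y * (w i + 1) := by
  obtain ⟨C, hC, h⟩ := y.2
  rw [← div_le_iff₀ (by positivity)]
  refine le_ciSup (f := fun i => ‖y.1 i‖ / ((w i : ℝ) + 1)) ⟨C, ?_⟩ i
  rintro _ ⟨j, rfl⟩
  exact (div_le_iff₀ (by positivity)).2 (h j)

lemma supNorm_le (y : WeightedProd w M) {C : ℝ} (hC : 0 ≤ C) (h : ∀ i, ‖y.1 i‖ ≤ C * (w i + 1)) :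
    supNorm y ≤ C :=
  Real.iSup_le (fun i => (div_le_iff₀ (by positivity)).2 (h i)) hC

noncomputable instance : NormedAddCommGroup (WeightedProd w M) :=
  AddGroupNorm.toNormedAddCommGroup
    { toFun := supNorm
      map_zero' := le_antisymm
        (supNorm_le _ le_rfl fun i => by
          change ‖(0 : BoundedMap R R (M i).carrier)‖ ≤ _
          simp) (supNorm_nonneg _)
      add_le' := fun y z =>
        supNorm_le _ (add_nonneg (supNorm_nonneg y) (supNorm_nonneg z)) fun i =>
          (norm_add_le (y.1 i) (z.1 i)).trans (by
            linarith [norm_apply_le_supNorm y i, norm_apply_le_supNorm z i])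
      neg' := fun y => iSup_congr fun i => congrArg (· / _) (norm_neg (y.1 i))
      eq_zero_of_map_eq_zero' := fun y hy => Subtype.ext (funext fun i => by
        have := norm_apply_le_supNorm y i
        rw [hy, zero_mul] at this
        exact norm_le_zero_iff.1 this) }

lemma norm_apply_le (y : WeightedProd w M) (i : ι) : ‖y.1 i‖ ≤ ‖y‖ * (w i + 1) :=
  norm_apply_le_supNorm y i

lemma norm_le (y : WeightedProd w M) {C : ℝ} (hC : 0 ≤ C) (h : ∀ i, ‖y.1 i‖ ≤ C * (w i + 1)) :
    ‖y‖ ≤ C :=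
  supNorm_le y hC h

instance : CompleteSpace (WeightedProd w M) := by
  refine Metric.complete_of_cauchySeq_tendsto fun f hf => ?_
  have hpt : ∀ i, CauchySeq fun n => (f n).1 i := fun i => by
    rw [Metric.cauchySeq_iff] at hf ⊢
    intro ε hε
    obtain ⟨K, hK⟩ := hf (ε / (w i + 1)) (by positivity)
    refine ⟨K, fun m hm n hn => ?_⟩
    have h1 := hK m hm n hn
    rw [dist_eq_norm] at h1 ⊢
    calc ‖(f m).1 i - (f n).1 i‖ ≤ ‖f m - f n‖ * (w i + 1) := norm_apply_le (f m - f n) i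
      _ < ε / (w i + 1) * (w i + 1) := by gcongr
      _ = ε := by field_simp
  choose g hg using fun i => cauchySeq_tendsto_of_complete (hpt i)
  obtain ⟨B, hB⟩ := hf.norm_bddAbove
  have hB' : ∀ n, ‖f n‖ ≤ B := fun n => hB ⟨n, rfl⟩
  have hB0 : 0 ≤ B := (norm_nonneg _).trans (hB' 0)
  refine ⟨⟨g, B, hB0, fun i => le_of_tendsto (hg i).norm (Filter.Eventually.of_forall fun n =>
      (norm_apply_le (f n) i).trans (by gcongr; exact hB' n))⟩, ?_⟩
  refine Metric.tendsto_atTop.2 fun ε hε => ?_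
  obtain ⟨K, hK⟩ := Metric.cauchySeq_iff.1 hf (ε / 2) (by positivity)
  refine ⟨K, fun n hn => ?_⟩
  refine (dist_eq_norm (f n) _).trans_lt (lt_of_le_of_lt
    (norm_le _ (C := ε / 2) (by positivity) fun i => ?_) (half_lt_self hε))
  refine le_of_tendsto (((tendsto_const_nhds (x := (f n).1 i)).sub (hg i)).norm) ?_
  filter_upwards [Filter.eventually_ge_atTop K] with k hk
  have h1 := hK n hn k hk
  rw [dist_eq_norm] at h1
  exact (norm_apply_le (f n - f k) i).trans (by gcongr)

noncomputable instance : BanachModule R (WeightedProd w M) where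
  exists_norm_smul_le := by
    obtain ⟨D, hD, h⟩ := BoundedMap.exists_norm_smul_homRing_le R
    refine ⟨D, hD, fun a y => norm_le _ (by positivity) fun i => ?_⟩
    calc ‖a • y.1 i‖ ≤ D * ‖a‖ * ‖y.1 i‖ := h _ a (y.1 i)
      _ ≤ D * ‖a‖ * (‖y‖ * (w i + 1)) := by gcongr; exact norm_apply_le y i
      _ = D * ‖a‖ * ‖y‖ * (w i + 1) := by ring
  complete := inferInstance

end WeightedProd

/-- The weighted `ℓ^∞`-product as an object of `Ban R`. -/
noncomputable def weightedProd : Ban R := of (WeightedProd w M)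

namespace weightedProd

variable {w M}

variable (w M) in
/-- The projections of the weighted product. -/
noncomputable def proj (i : ι) : weightedProd w M ⟶ M i where
  toMap := (BoundedMap.evalAt (M i).carrier (1 : R)).comp
    ⟨{ toFun := fun y => y.1 i
       map_add' := fun _ _ => rfl
       map_smul' := fun _ _ => rfl }, w i + 1, by positivity, fun y =>
        (WeightedProd.norm_apply_le y i).trans (mul_comm _ _).le⟩

/-- The projections evaluate at `1`, and a linear map out of `R` is determined by its value there.
-/
lemma hom_ext {X : Ban R} {f g : X ⟶ weightedProd w M} (h : ∀ i, f ≫ proj w M i = g ≫ proj w M i) :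
    f = g :=
  Ban.hom_ext' fun x => Subtype.ext (funext fun i => Subtype.ext (LinearMap.ext_ring
    (congrArg (fun k : X ⟶ M i => k.toMap.1 x) (h i))))

/-- A family of maps whose norms are bounded by the weights induces a map to the weighted
product. -/
noncomputable def lift {X : Ban R} (f : ∀ i, X ⟶ M i)
    (h : ∃ C : ℝ, 0 < C ∧ ∀ i,
      ‖(BoundedMap.toHomRing (R := R) _).comp (f i).toMap‖ ≤ C * (w i + 1)) :
    X ⟶ weightedProd w M where
  toMap :=
    have bound : ∃ C : ℝ, 0 < C ∧ ∀ i x,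
        ‖(BoundedMap.toHomRing (R := R) _).1 ((f i).toMap.1 x)‖ ≤ C * ‖x‖ * (w i + 1) := by
      obtain ⟨C, hC, h⟩ := h
      refine ⟨C, hC, fun i x => ?_⟩
      calc _ ≤ ‖(BoundedMap.toHomRing (R := R) _).comp (f i).toMap‖ * ‖x‖ :=
            BoundedMap.le_norm ((BoundedMap.toHomRing (R := R) _).comp (f i).toMap) x
        _ ≤ C * (w i + 1) * ‖x‖ := by gcongr; exact h i
        _ = C * ‖x‖ * (w i + 1) := by ring
    ⟨{ toFun := fun x => ⟨fun i => (BoundedMap.toHomRing (R := R) _).1 ((f i).toMap.1 x), by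
          obtain ⟨C, hC, h⟩ := bound
          exact ⟨C * ‖x‖, by positivity, fun i => h i x⟩⟩
       map_add' := fun x y => Subtype.ext (funext fun i =>
        map_add ((BoundedMap.toHomRing (R := R) _).comp (f i).toMap).1 x y)
       map_smul' := fun a x => Subtype.ext (funext fun i =>
        map_smul ((BoundedMap.toHomRing (R := R) _).comp (f i).toMap).1 a x) }, by
      obtain ⟨C, hC, h⟩ := bound
      exact ⟨C, hC, fun x => WeightedProd.norm_le _ (by positivity) fun i => h i x⟩⟩

lemma lift_proj {X : Ban R} (f : ∀ i, X ⟶ M i) (h) (i : ι) : lift (w := w) f h ≫ proj w M i = f i :=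
  Ban.hom_ext' fun x => by
    change (1 : R) • (f i).toMap.1 x = _
    rw [one_smul]

/-- No uniform bound on the `f i` is needed, because the weights are chosen after the family, as the
rounded-up norms. -/
lemma exists_lift {X : Ban R} (f : ∀ i, X ⟶ M i) :
    ∃ (w : ι → ℕ) (g : X ⟶ weightedProd w M), ∀ i, g ≫ proj w M i = f i :=
  ⟨fun i => ⌈‖(BoundedMap.toHomRing (R := R) _).comp (f i).toMap‖⌉₊,
    lift f ⟨1, one_pos, fun i => by
      rw [one_mul]
      exact (Nat.le_ceil _).trans (by linarith)⟩, lift_proj f _⟩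

lemma exists_transition {w w' : ι → ℕ} (h : w ≤ w') :
    ∃ g : weightedProd w M ⟶ weightedProd w' M, ∀ i, g ≫ proj w' M i = proj w M i :=
  ⟨{ toMap := ⟨
      { toFun := fun y => ⟨y.1, ‖y‖, norm_nonneg _, fun i =>
          (WeightedProd.norm_apply_le y i).trans
            (mul_le_mul_of_nonneg_left (by simpa using h i) (norm_nonneg y))⟩
        map_add' := fun _ _ => rfl
        map_smul' := fun _ _ => rfl }, 1, one_pos, fun y =>
          WeightedProd.norm_le _ (by positivity) fun i =>
            (WeightedProd.norm_apply_le y i).trans (by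
              rw [one_mul]
              exact mul_le_mul_of_nonneg_left (by simpa using h i) (norm_nonneg y))⟩ },
    fun _ => rfl⟩

open Classical in
variable (w M) in
/-- The inclusions of the factors into the weighted product. -/
noncomputable def incl (i : ι) : M i ⟶ weightedProd w M where
  toMap :=
    have bound : ∀ m : (M i).carrier, ∀ j,
        ‖(Pi.single i ((BoundedMap.toHomRing (R := R) _).1 m) :
          ∀ j, BoundedMap R R (M j).carrier) j‖ ≤
          ‖BoundedMap.toHomRing (R := R) (M i).carrier‖ / (w i + 1) * ‖m‖ * (w j + 1) :=
      fun m j => by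
        rcases eq_or_ne j i with rfl | hj
        · rw [Pi.single_eq_same]
          refine (BoundedMap.le_norm _ m).trans (le_of_eq ?_)
          field_simp
        · rw [Pi.single_eq_of_ne hj, norm_zero]
          positivity
    ⟨{ toFun := fun m => ⟨Pi.single i ((BoundedMap.toHomRing (R := R) _).1 m), _, by positivity,
          bound m⟩
       map_add' := fun m m' => Subtype.ext
        ((congrArg (Pi.single i) (map_add _ m m')).trans (Pi.single_add i _ _))
       map_smul' := fun a m => Subtype.ext
        ((congrArg (Pi.single i) (map_smul _ a m)).trans (Pi.single_smul i a _)) },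
      ‖BoundedMap.toHomRing (R := R) (M i).carrier‖ / (w i + 1) + 1, by positivity, fun m =>
        (WeightedProd.norm_le _ (by positivity) (bound m)).trans (by gcongr; linarith)⟩

open Classical in
lemma incl_proj_self (i : ι) (m : (M i).carrier) :
    (proj w M i).toMap.1 ((incl w M i).toMap.1 m) = m := by
  change ((Pi.single i ((BoundedMap.toHomRing (R := R) _).1 m) :
          ∀ j, BoundedMap R R (M j).carrier) i).1 1 = m
  rw [Pi.single_eq_same, BoundedMap.toHomRing_apply, one_smul]

open Classical in
lemma incl_proj_ne {i j : ι} (h : j ≠ i) (m : (M i).carrier) :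
    (proj w M j).toMap.1 ((incl w M i).toMap.1 m) = 0 := by
  change ((Pi.single i ((BoundedMap.toHomRing (R := R) _).1 m) :
          ∀ j, BoundedMap R R (M j).carrier) j).1 1 = 0
  rw [Pi.single_eq_of_ne h]
  rfl

open Classical in
-- A large weight shrinks the corresponding inclusion; this is what lets weights force convergence.
lemma norm_incl_le (i : ι) : ‖(incl w M i).toMap‖ ≤
    ‖BoundedMap.toHomRing (R := R) (M i).carrier‖ / (w i + 1) := by
  refine BoundedMap.norm_le _ (by positivity) fun m =>
    WeightedProd.norm_le _ (by positivity) fun j => ?_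
  change ‖(Pi.single i ((BoundedMap.toHomRing (R := R) _).1 m) :
          ∀ j, BoundedMap R R (M j).carrier) j‖ ≤ _
  rcases eq_or_ne j i with rfl | hj
  · rw [Pi.single_eq_same]
    refine (BoundedMap.le_norm _ m).trans (le_of_eq ?_)
    field_simp
  · rw [Pi.single_eq_of_ne hj, norm_zero]
    positivity

/-- If the weights grow fast enough, then the sum of countably many given tensors converges in the
tensor product with the weighted product. -/
lemma exists_summable_lTensor_incl [Countable ι] {A : Type u} [NormedAddCommGroup A]
    [BanachModule R A] (t : ∀ i, ProjTensor R A (M i).carrier) :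
    ∃ w : ι → ℕ, Summable fun i => (ProjTensor.lTensor A (incl w M i).toMap).1 (t i) := by
  have := Encodable.ofCountable ι
  -- With this weight the bound from `norm_incl_le` makes the `i`-th term at most `2 ^ (-encode i)`.
  refine ⟨fun i => ⌈‖BoundedMap.toHomRing (R := R) (M i).carrier‖ * ‖t i‖ *
    2 ^ Encodable.encode i⌉₊, Summable.of_norm_bounded summable_geometric_two_encode fun i => ?_⟩
  refine (ProjTensor.norm_lTensor_apply_le _ _).trans ?_
  refine (mul_le_mul_of_nonneg_right (norm_incl_le i) (norm_nonneg _)).trans ?_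
  rw [div_mul_eq_mul_div, div_le_iff₀ (by positivity), one_div, inv_pow, ← div_eq_inv_mul,
    le_div_iff₀ (by positivity)]
  exact (Nat.le_ceil _).trans (by linarith)

end weightedProd

end WeightedProduct

/-! ### Additive structure -/

/-- Morphisms in `Ban R` are the same thing as bounded maps. -/
def homEquiv (V W : Ban R) : (V ⟶ W) ≃ BoundedMap R V.carrier W.carrier where
  toFun := Hom.toMap
  invFun := Hom.mk

noncomputable instance : Preadditive (Ban R) where
  homGroup V W := (homEquiv V W).addCommGroup
  add_comp _ _ _ f f' g := hom_ext' fun x => map_add g.toMap.1 (f.toMap.1 x) (f'.toMap.1 x)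
  comp_add _ _ _ _ _ _ := rfl

/-- Finitely many norms have a common bound, so the unweighted sup-norm product is already
universal. -/
lemma hasProductsOfShape_of_finite (ι : Type u) [Finite ι] :
    HasLimitsOfShape (Discrete ι) (Ban R) :=
  have (M : ι → Ban R) : HasProduct M :=
    ⟨⟨Fan.mk (weightedProd 0 M) (weightedProd.proj 0 M),
      Fan.IsLimit.mk _
        (fun s => weightedProd.lift s.proj (by
          obtain ⟨C, hC⟩ := (Set.finite_range fun i =>
            ‖(BoundedMap.toHomRing (R := R) _).comp (s.proj i).toMap‖).bddAbove
          exact ⟨max C 1, by positivity, fun i => by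
            simpa using Or.inl (hC ⟨i, rfl⟩)⟩))
        (fun s i => weightedProd.lift_proj _ _ i)
        (fun s m hm => weightedProd.hom_ext fun i =>
          (hm i).trans (weightedProd.lift_proj _ _ i).symm)⟩⟩
  ⟨fun F => hasLimit_of_iso Discrete.natIsoFunctor.symm⟩

instance : HasFiniteBiproducts (Ban R) :=
  have : HasFiniteProducts (Ban R) := ⟨fun n =>
    have := hasProductsOfShape_of_finite (R := R) (ULift.{u} (Fin n))
    hasLimitsOfShape_of_equivalence (Discrete.equivalence Equiv.ulift)⟩
  .of_hasFiniteProducts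

end Ban

/-! ### Maps from representables into filtered colimits of ind-objects. -/

namespace IndExt

universe v w

variable {C : Type w} [Category.{v} C]

/-- The Yoneda lemma for ind-objects: the value of the presheaf underlying `V` at `Z` is the set of
morphisms `Z ⟶ V`. -/
noncomputable def inclusionEvaluationIso (Z : C) :
    Ind.inclusion C ⋙ (evaluation Cᵒᵖ (Type v)).obj (Opposite.op Z) ≅
      coyoneda.obj (Opposite.op (Ind.yoneda.obj Z)) :=
  (NatIso.ofComponents
    (fun V => (Ind.inclusion.fullyFaithful.homEquiv.trans
      (((Ind.yonedaCompInclusion.app Z).homCongr (Iso.refl _)).trans yonedaEquiv)).toIso)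
    (fun f => by
      ext g
      simp [yonedaEquiv_apply, Functor.FullyFaithful.homEquiv])).symm

/-- Representables are compact: filtered colimits in `Ind C` are computed in presheaves, hence
pointwise, and `Hom` from a representable is evaluation. A small final subcategory reduces the
possibly large index to a small one. -/
lemma preservesColimitsOfShape_coyoneda_yoneda (Z : C) (J : Type*) [Category.{v} J] [IsFiltered J]
    [FinallySmall.{v} J] :
    PreservesColimitsOfShape J (coyoneda.obj (Opposite.op (Ind.yoneda.obj Z))) :=
  have : PreservesColimitsOfShape (FinallySmall.FilteredFinalModel.{v} J)
      (coyoneda.obj (Opposite.op (Ind.yoneda.obj Z))) :=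
    preservesColimitsOfShape_of_natIso (inclusionEvaluationIso Z)
  Functor.Final.preservesColimitsOfShape_of_final
    (FinallySmall.fromFilteredFinalModel.{v} J) _

section

variable {J : Type*} [Category.{v} J] [IsFiltered J] [FinallySmall.{v} J] {K : J ⥤ Ind C}
  {c : Cocone K} (hc : IsColimit c) {Z : C}

include hc

lemma exists_factor_of_isColimit (f : Ind.yoneda.obj Z ⟶ c.pt) :
    ∃ (j : J) (g : Ind.yoneda.obj Z ⟶ K.obj j), g ≫ c.ι.app j = f := by
  have := preservesColimitsOfShape_coyoneda_yoneda Z J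
  exact Types.jointly_surjective_of_isColimit
    (isColimitOfPreserves (coyoneda.obj (Opposite.op (Ind.yoneda.obj Z))) hc) f

lemma exists_eq_of_isColimit {i j : J} (f : Ind.yoneda.obj Z ⟶ K.obj i)
    (g : Ind.yoneda.obj Z ⟶ K.obj j) (h : f ≫ c.ι.app i = g ≫ c.ι.app j) :
    ∃ (k : J) (a : i ⟶ k) (b : j ⟶ k), f ≫ K.map a = g ≫ K.map b := by
  have := preservesColimitsOfShape_coyoneda_yoneda Z J
  exact (Types.FilteredColimit.isColimit_eq_iff _
    (isColimitOfPreserves (coyoneda.obj (Opposite.op (Ind.yoneda.obj Z))) hc)).1 h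

end

lemma isIso_of_bijective {V W : Ind C} (f : V ⟶ W)
    (h : ∀ Z : C, Function.Bijective fun g : Ind.yoneda.obj Z ⟶ V => g ≫ f) : IsIso f := by
  have : IsIso ((Ind.inclusion C).map f) := by
    rw [NatTrans.isIso_iff_isIso_app]
    intro Z
    have h1 : IsIso ((coyoneda.obj (Opposite.op (Ind.yoneda.obj Z.unop))).map f) :=
      (isIso_iff_bijective _).2 (h Z.unop)
    exact (NatIso.isIso_map_iff (inclusionEvaluationIso Z.unop) f).2 h1
  exact isIso_of_reflects_iso f (Ind.inclusion C)

section

variable (F : C ⥤ C) {V : Ind C} {Z : C}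

lemma exists_factor_extendι (f : Ind.yoneda.obj Z ⟶ (extend F).obj V) :
    ∃ (j : CostructuredArrow (Ind.yoneda (C := C)) V) (g : Z ⟶ F.obj j.left),
      Ind.yoneda.map g ≫ extendι F j = f := by
  obtain ⟨h₁, h₂⟩ := isFiltered_finallySmall V
  obtain ⟨j, g, hg⟩ := exists_factor_of_isColimit
    (colimit.isColimit (CostructuredArrow.proj Ind.yoneda V ⋙ F ⋙ Ind.yoneda)) f
  obtain ⟨g, rfl⟩ := (Ind.yoneda (C := C)).map_surjective g
  exact ⟨j, g, hg⟩

lemma exists_eq_extendι {i j : CostructuredArrow (Ind.yoneda (C := C)) V} (f : Z ⟶ F.obj i.left)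
    (g : Z ⟶ F.obj j.left)
    (h : Ind.yoneda.map f ≫ extendι F i = Ind.yoneda.map g ≫ extendι F j) :
    ∃ (k : CostructuredArrow (Ind.yoneda (C := C)) V) (a : i ⟶ k) (b : j ⟶ k),
      f ≫ F.map a.left = g ≫ F.map b.left := by
  obtain ⟨h₁, h₂⟩ := isFiltered_finallySmall V
  obtain ⟨k, a, b, hk⟩ := exists_eq_of_isColimit
    (colimit.isColimit (CostructuredArrow.proj Ind.yoneda V ⋙ F ⋙ Ind.yoneda)) _ _ h
  refine ⟨k, a, b, (Ind.yoneda (C := C)).map_injective ?_⟩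
  rw [Functor.map_comp, Functor.map_comp]
  exact hk

lemma map_extendι {i j : CostructuredArrow (Ind.yoneda (C := C)) V} (a : i ⟶ j) :
    Ind.yoneda.map (F.map a.left) ≫ extendι F j = extendι F i :=
  colimit.w (CostructuredArrow.proj Ind.yoneda V ⋙ F ⋙ Ind.yoneda) a

end

variable {F G : C ⥤ C} (τ : F ⟶ G) {V : Ind C}

/-- If the extension of `τ` is an isomorphism at `V`, then sections of `G` lift locally
along `τ`. -/
lemma exists_lift_of_isIso_extendMapApp [IsIso (extendMapApp τ V)] {X Z : C}
    (f : Ind.yoneda.obj X ⟶ V) (z : Z ⟶ G.obj X) :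
    ∃ (Y : C) (φ : X ⟶ Y) (g : Ind.yoneda.obj Y ⟶ V) (t : Z ⟶ F.obj Y),
      Ind.yoneda.map φ ≫ g = f ∧ t ≫ τ.app Y = z ≫ G.map φ := by
  let i : CostructuredArrow (Ind.yoneda (C := C)) V := CostructuredArrow.mk f
  obtain ⟨j, t, ht⟩ := exists_factor_extendι F
    ((Ind.yoneda.map z ≫ extendι G i) ≫ inv (extendMapApp τ V))
  have h : Ind.yoneda.map (t ≫ τ.app j.left) ≫ extendι G j =
      Ind.yoneda.map (show Z ⟶ G.obj i.left from z) ≫ extendι G i := by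
    rw [Functor.map_comp, Category.assoc, ← extendι_mapApp, ← Category.assoc, ht, Category.assoc,
      IsIso.inv_hom_id, Category.comp_id]
  -- The lift `t` and the section `z` agree only in the colimit of `G`, so the equality is realized
  -- at a later stage `k`.
  obtain ⟨k, a, b, hk⟩ := exists_eq_extendι G _ _ h
  refine ⟨k.left, b.left, k.hom, t ≫ F.map a.left, CostructuredArrow.w b, ?_⟩
  rw [Category.assoc, τ.naturality, ← Category.assoc]
  exact hk

/-- If every `X ⟶ V` factors through some `φ : X ⟶ Y` such that `τ` has an inverse up to `φ`, then
the extension of `τ` is an isomorphism at `V`. -/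
lemma isIso_extendMapApp (h : ∀ (X : C) (f : Ind.yoneda.obj X ⟶ V),
    ∃ (Y : C) (φ : X ⟶ Y) (g : Ind.yoneda.obj Y ⟶ V) (s : G.obj X ⟶ F.obj Y),
      Ind.yoneda.map φ ≫ g = f ∧ s ≫ τ.app Y = G.map φ ∧ τ.app X ≫ s = F.map φ) :
    IsIso (extendMapApp τ V) := by
  have h' : ∀ i : CostructuredArrow (Ind.yoneda (C := C)) V,
      ∃ (j : CostructuredArrow (Ind.yoneda (C := C)) V) (a : i ⟶ j)
        (s : G.obj i.left ⟶ F.obj j.left),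
        s ≫ τ.app j.left = G.map a.left ∧ τ.app i.left ≫ s = F.map a.left := fun i => by
    obtain ⟨Y, φ, g, s, hg, hs⟩ := h i.left i.hom
    exact ⟨CostructuredArrow.mk g, CostructuredArrow.homMk φ hg, s, hs⟩
  refine isIso_of_bijective _ fun Z => ⟨fun f f' hf => ?_, fun f => ?_⟩
  · obtain ⟨i, g, rfl⟩ := exists_factor_extendι F f
    obtain ⟨i', g', rfl⟩ := exists_factor_extendι F f'
    dsimp only at hf
    simp only [Category.assoc, extendι_mapApp] at hf
    simp only [← Category.assoc, ← Functor.map_comp] at hf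
    obtain ⟨k, a, b, hk⟩ := exists_eq_extendι G _ _ hf
    -- At stage `k` the representatives agree after `τ`; the partial inverse `s` cancels `τ` at the
    -- cost of moving on to `l`.
    obtain ⟨l, c, s, hs, hs'⟩ := h' k
    have key : g ≫ F.map (a ≫ c).left = g' ≫ F.map (b ≫ c).left := by
      have := hk =≫ s
      simpa only [Category.assoc, ← τ.naturality_assoc, hs', ← Functor.map_comp,
        ← CostructuredArrow.comp_left] using this
    rw [← map_extendι F (a ≫ c), ← map_extendι F (b ≫ c), ← Category.assoc, ← Functor.map_comp, key,
      Functor.map_comp, Category.assoc]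
  · obtain ⟨i, g, rfl⟩ := exists_factor_extendι G f
    obtain ⟨j, a, s, hs, -⟩ := h' i
    refine ⟨Ind.yoneda.map (g ≫ s) ≫ extendι F j, ?_⟩
    dsimp only
    rw [Category.assoc, extendι_mapApp, ← Category.assoc, ← Functor.map_comp, Category.assoc, hs,
      Functor.map_comp, Category.assoc, map_extendι]

end IndExt

/-! ### The trace class criterion and countable products. -/

namespace IndBan

variable {R : Type u} [BanachRing R]

/-- An ind-object is nuclear if and only if every morphism to it from a Banach module factors
through a map that comes from an element of `X^∨ ⊗̂ Y`. -/
theorem isNuclear_iff (V : Ind (Ban R)) : IsNuclear V ↔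
    ∀ (X : Ban R) (f : Ind.yoneda.obj X ⟶ V), ∃ (Y : Ban R)
      (t : ProjTensor R (BoundedMap R X.carrier R) Y.carrier) (g : Ind.yoneda.obj Y ⟶ V),
      Ind.yoneda.map (⟨(ProjTensor.dualToHom X.carrier Y.carrier).1 t⟩ : X ⟶ Y) ≫ g = f := by
  constructor
  · intro hV X f
    have : IsIso (IndExt.extendMapApp X.dualTensorToHom V) := hV X
    -- The section lifted is `R ⟶ Hom(X, X)`, `1 ↦ id`; the value of its lift at `1` is the tensor
    -- sought.
    obtain ⟨Y, φ, g, t, hg, ht⟩ := IndExt.exists_lift_of_isIso_extendMapApp X.dualTensorToHom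
      (Z := Ban.unit R) f
      ⟨(BoundedMap.toHomRing (R := R) (BoundedMap R X.carrier X.carrier)).1 BoundedMap.id⟩
    refine ⟨Y, t.toMap.1 (1 : R), g, ?_⟩
    rw [← hg]
    congr 2
    refine Ban.hom_ext' fun x => ?_
    have h1 := congrArg (fun k : Ban.unit R ⟶ X.internalHom.obj Y => (k.toMap.1 (1 : R)).1 x) ht
    refine h1.trans ?_
    change φ.toMap.1 ((1 : R) • x) = _
    rw [one_smul]
  · intro h W
    refine IndExt.isIso_extendMapApp W.dualTensorToHom fun X f => ?_
    obtain ⟨Y, t, g, hg⟩ := h X f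
    exact ⟨Y, _, g, ⟨(ProjTensor.pullback W.carrier X.carrier Y.carrier).1 t⟩, hg,
      Ban.hom_ext' fun k => ProjTensor.dualToHom_pullback t k,
      Ban.hom_ext' fun z => ProjTensor.pullback_dualToHom t z⟩

lemma IsNuclear.of_iso {V V' : Ind (Ban R)} (e : V ≅ V') (h : IsNuclear V) : IsNuclear V' := by
  rw [isNuclear_iff] at h ⊢
  intro X f
  obtain ⟨Y, t, g, hg⟩ := h X (f ≫ e.inv)
  exact ⟨Y, t, g ≫ e.hom, by rw [← Category.assoc, hg, Category.assoc, e.inv_hom_id,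
    Category.comp_id]⟩

/-- The tensors of the components are summed inside one weighted product, and the projection to the
factor `j` recovers the `j`-th component. -/
lemma isNuclear_of_isLimit_fan {ι : Type u} [Countable ι] {V : ι → Ind (Ban R)}
    (hV : ∀ i, IsNuclear (V i)) (P : Fan V) (hP : IsLimit P) : IsNuclear P.pt := by
  rw [isNuclear_iff]
  intro X f
  choose Y t g hg using fun i => (isNuclear_iff (V i)).1 (hV i) X (f ≫ P.proj i)
  obtain ⟨w, hw⟩ := Ban.weightedProd.exists_summable_lTensor_incl t
  refine ⟨Ban.weightedProd w Y,
    ∑' i, (ProjTensor.lTensor (BoundedMap R X.carrier R)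
      (Ban.weightedProd.incl w Y i).toMap).1 (t i),
    Fan.IsLimit.lift hP fun i => Ind.yoneda.map (Ban.weightedProd.proj w Y i) ≫ g i, ?_⟩
  refine Fan.IsLimit.hom_ext hP _ _ fun j => ?_
  rw [Category.assoc, Fan.IsLimit.fac, ← Category.assoc, ← Functor.map_comp, ← hg]
  congr 2
  refine Ban.hom_ext' fun x => ?_
  -- `T` turns a tensor into its map, evaluates at `x` and projects to `Y j`. Being continuous, it
  -- commutes with the infinite sum, and only the term at `j` survives.
  let T : BoundedMap R (ProjTensor R (BoundedMap R X.carrier R) (Ban.weightedProd w Y).carrier)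
      (Y j).carrier :=
    (Ban.weightedProd.proj w Y j).toMap.comp ((BoundedMap.evalAt _ x).comp
      (ProjTensor.dualToHom X.carrier (Ban.weightedProd w Y).carrier))
  have hT : ∀ i, T.1 ((ProjTensor.lTensor (BoundedMap R X.carrier R)
      (Ban.weightedProd.incl w Y i).toMap).1 (t i)) =
      (Ban.weightedProd.proj w Y j).toMap.1 ((Ban.weightedProd.incl w Y i).toMap.1
        (((ProjTensor.dualToHom X.carrier (Y i).carrier).1 (t i)).1 x)) := fun i =>
    congrArg (fun k : BoundedMap R (ProjTensor R (BoundedMap R X.carrier R) (Y i).carrier)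
        (BoundedMap R X.carrier (Ban.weightedProd w Y).carrier) =>
      (Ban.weightedProd.proj w Y j).toMap.1 ((k.1 (t i)).1 x))
      (ProjTensor.dualToHom_natural (M := X.carrier) (Ban.weightedProd.incl w Y i).toMap)
  have hsum := hw.hasSum.map T.1 T.continuous
  refine hsum.unique ?_
  convert hasSum_single j fun i hi => ?_
  · exact ((hT j).trans (Ban.weightedProd.incl_proj_self j _)).symm
  · exact (hT i).trans (Ban.weightedProd.incl_proj_ne hi.symm _)

end IndBan

/-! ### Products of representables are ind-objects. -/

namespace Ban

variable {R : Type u} [BanachRing R]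

/-- Every map from a representable factors through some weighted product, via a unique map for the
given weight. These products are directed by the order on weights and indexed by the small set `ι →
ℕ`, so the category of elements is filtered and finally small. -/
lemma isIndObject_pi_yoneda {ι : Type u} (M : ι → Ban R) :
    IsIndObject (∏ᶜ yoneda.obj ∘ M) := by
  let q (w : ι → ℕ) : yoneda.obj (weightedProd w M) ⟶ ∏ᶜ yoneda.obj ∘ M :=
    Pi.lift fun i => yoneda.map (weightedProd.proj w M i)
  have hq : ∀ (w : ι → ℕ) (i : ι), q w ≫ Pi.π _ i = yoneda.map (weightedProd.proj w M i) :=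
    fun w i => Pi.lift_π _ i
  have q_mono : ∀ {w : ι → ℕ} {X : Ban R} {a b : X ⟶ weightedProd w M},
      yoneda.map a ≫ q w = yoneda.map b ≫ q w → a = b := fun {w X a b} h =>
    weightedProd.hom_ext fun i => yoneda.map_injective (by
      rw [Functor.map_comp, Functor.map_comp, ← hq, ← Category.assoc, h, Category.assoc])
  have exists_q : ∀ {X : Ban R} (x : yoneda.obj X ⟶ ∏ᶜ yoneda.obj ∘ M),
      ∃ (w : ι → ℕ) (a : X ⟶ weightedProd w M), yoneda.map a ≫ q w = x := fun {X} x => by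
    choose f hf using fun i => yoneda.map_surjective (X := X) (Y := M i) (x ≫ Pi.π _ i)
    obtain ⟨w, a, ha⟩ := weightedProd.exists_lift f
    refine ⟨w, a, Pi.hom_ext _ _ fun i => ?_⟩
    rw [Category.assoc, hq, ← Functor.map_comp, ha, hf]
  have q_le : ∀ {w w' : ι → ℕ}, w ≤ w' →
      ∃ a : weightedProd w M ⟶ weightedProd w' M, yoneda.map a ≫ q w' = q w := fun {w w'} h => by
    obtain ⟨a, ha⟩ := weightedProd.exists_transition (M := M) h
    refine ⟨a, Pi.hom_ext _ _ fun i => ?_⟩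
    rw [Category.assoc, hq, hq, ← Functor.map_comp, ha]
  have : IsFiltered (CostructuredArrow yoneda (∏ᶜ yoneda.obj ∘ M)) :=
    { nonempty := ⟨CostructuredArrow.mk (q 0)⟩
      cocone_objs := fun X Y => by
        obtain ⟨w, a, ha⟩ := exists_q X.hom
        obtain ⟨w', b, hb⟩ := exists_q Y.hom
        obtain ⟨c, hc⟩ := q_le (le_sup_left (a := w) (b := w'))
        obtain ⟨d, hd⟩ := q_le (le_sup_right (a := w) (b := w'))
        exact ⟨CostructuredArrow.mk (q (w ⊔ w')),
          CostructuredArrow.homMk (a ≫ c) (by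
            rw [Functor.map_comp, Category.assoc, ← ha, ← hc]; rfl),
          CostructuredArrow.homMk (b ≫ d) (by
            rw [Functor.map_comp, Category.assoc, ← hb, ← hd]; rfl), trivial⟩
      -- Any factorization of `Y` through some `q w` equalizes `f` and `g`, because `q w` is monic
      -- on representables.
      cocone_maps := fun X Y f g => by
        obtain ⟨w, a, ha⟩ := exists_q Y.hom
        refine ⟨CostructuredArrow.mk (q w), CostructuredArrow.homMk a ha,
          CostructuredArrow.hom_ext _ _ (q_mono ?_)⟩
        change yoneda.map (f.left ≫ a) ≫ q w = yoneda.map (g.left ≫ a) ≫ q w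
        rw [Functor.map_comp, Functor.map_comp, Category.assoc, Category.assoc, ha,
          CostructuredArrow.w f, CostructuredArrow.w g] }
  have : FinallySmall.{u} (CostructuredArrow yoneda (∏ᶜ yoneda.obj ∘ M)) :=
    finallySmall_of_small_weakly_terminal_set
      (Set.range fun w : ι → ℕ => CostructuredArrow.mk (q w)) fun X => by
        obtain ⟨w, a, ha⟩ := exists_q X.hom
        exact ⟨_, ⟨w, rfl⟩, ⟨CostructuredArrow.homMk a ha⟩⟩
  exact isIndObject_of_isFiltered_of_finallySmall _

end Ban

/-! ### Existence of products, and coproducts by finite approximation. -/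

namespace IndBan

variable {R : Type u} [BanachRing R]

/-- Products of ind-objects are again ind-objects as soon as products of representables are, so they
can be formed in presheaves. -/
lemma hasLimitsOfShape_discrete (ι : Type u) : HasLimitsOfShape (Discrete ι) (Ind (Ban R)) := by
  have : ObjectProperty.IsClosedUnderLimitsOfShape (IsIndObject (C := Ban R)) (Discrete ι) :=
    .mk' (by
      rintro _ ⟨F, hF⟩
      exact isIndObject_limit_of_discrete Ban.isIndObject_pi_yoneda F hF)
  have : CreatesLimitsOfShape (Discrete ι) (Ind.inclusion (Ban R)) :=
    inferInstance (α := CreatesLimitsOfShape (Discrete ι)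
      ((Ind.equivalence (Ban R)).functor ⋙ ObjectProperty.ι _))
  exact hasLimitsOfShape_of_hasLimitsOfShape_createsLimitsOfShape (Ind.inclusion (Ban R))

universe w

theorem hasProduct_and_isNuclear {ι : Type w} [Countable ι] {V : ι → Ind (Ban R)} (hV : ∀ i, IsNuclear (V i)) :
    HasProduct V ∧ ∀ P : Fan V, Nonempty (IsLimit P) → IsNuclear P.pt := by
  -- A countable index set in any universe is replaced by a copy in `Type u`.
  let e := equivShrink.{u} ι
  have := hasLimitsOfShape_discrete (R := R) (Shrink.{u} ι)
  have : HasLimitsOfShape (Discrete ι) (Ind (Ban R)) :=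
    hasLimitsOfShape_of_equivalence (Discrete.equivalence e.symm)
  refine ⟨inferInstance, fun P ⟨hP⟩ => ?_⟩
  have : Countable (Shrink.{u} ι) := e.symm.injective.countable
  exact (isNuclear_of_isLimit_fan (fun i => hV (e.symm i)) _ (limit.isLimit _)).of_iso
    (Pi.reindex e.symm V ≪≫ (limit.isLimit _).conePointUniqueUpToIso hP)

/-- Finite coproducts in `Ind (Ban R)` are also products, because both are computed by the
biproducts of compatible presentations. -/
lemma isNuclear_sigma_of_finite {ι : Type u} [Finite ι] {V : ι → Ind (Ban R)}
    (hV : ∀ i, IsNuclear (V i)) : IsNuclear (∐ V) := by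
  let I : ι → Type u := fun i => (V i).presentation.I
  -- All `V i` are presented over the common index `∀ i, I i`; this does not change the colimits,
  -- since the evaluation functors are final.
  let F (i : ι) : (∀ i, I i) ⥤ Ban R := Pi.eval I i ⋙ (V i).presentation.F
  let e (i : ι) : (Ind.lim (∀ i, I i)).obj (F i) ≅ V i :=
    Functor.Final.colimitIso (Pi.eval I i) ((V i).presentation.F ⋙ Ind.yoneda) ≪≫
      (V i).colimitPresentationCompYoneda
  have := Fintype.ofFinite ι
  have := Ban.hasProductsOfShape_of_finite (R := R) ι
  have : PreservesLimitsOfShape (Discrete ι) (Ind.lim (C := Ban R) (∀ i, I i)) := inferInstance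
  have : PreservesColimitsOfShape (Discrete ι) (Ind.lim (C := Ban R) (∀ i, I i)) := inferInstance
  have := hasLimitsOfShape_discrete (R := R) ι
  have : HasFiniteBiproducts ((∀ i, I i) ⥤ Ban R) := .of_hasFiniteProducts
  have h : IsNuclear (∏ᶜ fun i => (Ind.lim (∀ i, I i)).obj (F i)) :=
    (hasProduct_and_isNuclear fun i => (hV i).of_iso (e i).symm).2 _ ⟨limit.isLimit _⟩
  -- `Ind.lim` preserves finite products and finite coproducts, so the biproduct of the diagrams `F
  -- i` identifies the two.
  exact h.of_iso ((PreservesProduct.iso (Ind.lim (∀ i, I i)) F).symm ≪≫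
    (Ind.lim (∀ i, I i)).mapIso ((biproduct.isoProduct F).symm ≪≫ biproduct.isoCoproduct F) ≪≫
    PreservesCoproduct.iso (Ind.lim (∀ i, I i)) F ≪≫ Sigma.mapIso e)

theorem hasCoproduct_and_isNuclear {ι : Type u} {V : ι → Ind (Ban R)} (hV : ∀ i, IsNuclear (V i)) :
    HasCoproduct V ∧ ∀ S : Cofan V, Nonempty (IsColimit S) → IsNuclear S.pt := by
  refine ⟨inferInstance, fun S ⟨hS⟩ => IsNuclear.of_iso
    ((colimit.isColimit _).coconePointUniqueUpToIso hS) ?_⟩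
  change IsNuclear (∐ V)
  rw [isNuclear_iff]
  intro X f
  classical
  have := essentiallySmallSelf (Finset (Discrete ι))
  have : FinallySmall.{u} (Finset (Discrete ι)) := finallySmall_of_essentiallySmall _
  -- By compactness of `X`, the map `f` already lands in the coproduct over a finite set `s`.
  obtain ⟨s, g, hg⟩ := IndExt.exists_factor_of_isColimit
    (CoproductsFromFiniteFiltered.isColimitFiniteSubproductsCocone V) f
  have hs : IsNuclear ((CoproductsFromFiniteFiltered.liftToFinsetObj (Discrete.functor V)).obj s) :=
    isNuclear_sigma_of_finite fun i => hV i.1.as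
  obtain ⟨Y, t, k, hk⟩ := (isNuclear_iff _).1 hs X g
  exact ⟨Y, t, k ≫ (CoproductsFromFiniteFiltered.finiteSubcoproductsCocone V).ι.app s,
    (Category.assoc _ _ _).symm.trans ((congrArg (· ≫ _) hk).trans hg)⟩

end IndBan

theorem mainTheorem9 (R : Type u) [BanachRing R] :
    (∀ (ι : Type*) [Countable ι] (V : ι → Ind (Ban R)), (∀ i, IndBan.IsNuclear (V i)) →
      HasProduct V ∧ ∀ P : Fan V, Nonempty (IsLimit P) → IndBan.IsNuclear P.pt) ∧
    (∀ (ι : Type u) (V : ι → Ind (Ban R)), (∀ i, IndBan.IsNuclear (V i)) →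
      HasCoproduct V ∧ ∀ S : Cofan V, Nonempty (IsColimit S) → IndBan.IsNuclear S.pt) :=
  ⟨fun _ _ _ hV => IndBan.hasProduct_and_isNuclear hV, fun _ _ hV => IndBan.hasCoproduct_and_isNuclear hV⟩
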